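/- Let $M$ be a closed (compact, without boundary), aspherical topological $3$-manifold, i.e. $M$ is path connected and $\pi_n(M)=0$ for all $n\ge 2$. For a space $X$, write $\mathrm{rk}_2 X=\dim_{\mathbb Z_2} H_1(X;\mathbb Z_2)$. Set $r=\mathrm{rk}_2 M$, and let $t$ be the dimension of the subspace of $H^2(M;\mathbb Z_2)$ spanned by the image of the cup product $H^1(M;\mathbb Z_2)\times H^1(M;\mathbb Z_2)\to H^2(M;\mathbb Z_2)$; both $r$ and $t$ are finite. (1) Let $\Gamma=\pi_1(M)$, set $\Gamma_0=\Gamma$, and for $d\ge0$ let $\Gamma_{d+1}$ be the subgroup of $\Gamma$ generated by all elements $gag^{-1}a^{-1}b^2$ with $g\in\Gamma$ and $a,b\in\Gamma_d$. Then the $\mathbb Z_2$-vector space $\Gamma_1/\Gamma_2$ has finite dimension, equal to $$\frac{r(r+1)}2-t.$$ (2) For every integer $m\ge 0$ and every regular (connected) covering $\widetilde M\to M$ whose group of covering transformations is isomorphic to $(\mathbb Z_2)^m$, the dimension $\mathrm{rk}_2\widetilde M$ is finite and $$\mathrm{rk}_2\widetilde M\ \ge\ (m+1)\,r-\frac{m(m+1)}2-t.$$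 -/

import Mathlib

open CategoryTheory Simplicial Topology

universe u v

/-! ### Singular homology and cohomology, cup product -/

/-- The singular homology `H_n(X; ℤ/2)`, as a vector space over `ℤ/2`. -/
noncomputable abbrev singularHomologyModTwo (n : ℕ) (X : Type u) [TopologicalSpace X] :
    ModuleCat.{u} (ZMod 2) :=
  ((AlgebraicTopology.singularHomologyFunctor (ModuleCat.{u} (ZMod 2)) n).obj
    (ModuleCat.of (ZMod 2) (ULift.{u} (ZMod 2)))).obj (TopCat.of X)

/-- The dimension of `H_1(X; ℤ/2)`. -/
noncomputable def rkModTwo (X : Type u) [TopologicalSpace X] : ℕ :=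
  Module.finrank (ZMod 2) (singularHomologyModTwo 1 X)

/-- The singular `n`-simplices of `X`, i.e. the continuous maps from the standard `n`-simplex
to `X`, as the `n`-simplices of the singular simplicial set. -/
abbrev SingularSimplex (X : Type u) [TopologicalSpace X] (n : ℕ) : Type u :=
  (TopCat.toSSet.obj (TopCat.of X)) _⦋n⦌

/-- Singular `n`-cochains of `X` with coefficients in `R`. -/
abbrev SingularCochain (R : Type v) [CommRing R] (X : Type u) [TopologicalSpace X] (n : ℕ) :
    Type (max u v) :=
  SingularSimplex X n → R

section Cohomology

variable (R : Type v) [CommRing R] (X : Type u) [TopologicalSpace X]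

/-- The coboundary `(δ f)(σ) = ∑ i, (-1) ^ i f(d_i σ)`, with `d_i σ` the `i`-th face of `σ`. -/
noncomputable def singularCoboundary (n : ℕ) :
    SingularCochain R X n →ₗ[R] SingularCochain R X (n + 1) where
  toFun f := fun σ => ∑ i : Fin (n + 2), (-1 : R) ^ (i : ℕ) *
    f ((TopCat.toSSet.obj (TopCat.of X)).δ i σ)
  map_add' f g := by
    funext σ
    simp [mul_add, Finset.sum_add_distrib]
  map_smul' c f := by
    funext σ
    simp [Finset.mul_sum, mul_left_comm]

/-- The singular `n`-cocycles. -/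
noncomputable def singularCocycles (n : ℕ) : Submodule R (SingularCochain R X n) :=
  LinearMap.ker (singularCoboundary R X n)

/-- The singular `n`-coboundaries. -/
noncomputable def singularCoboundaries (n : ℕ) : Submodule R (SingularCochain R X n) :=
  match n with
  | 0 => ⊥
  | k + 1 => LinearMap.range (singularCoboundary R X k)

/-- The singular cohomology `H^n(X; R)`. -/
abbrev SingularCohomology (n : ℕ) : Type (max u v) :=
  singularCocycles R X n ⧸ (singularCoboundaries R X n).submoduleOf (singularCocycles R X n)

variable {X}

/-- The front `p`-face `σ|[v_0, …, v_p]` of a singular `(p + q)`-simplex. -/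
noncomputable def frontFace (p q : ℕ) (σ : SingularSimplex X (p + q)) : SingularSimplex X p :=
  (TopCat.toSSet.obj (TopCat.of X)).map (SimplexCategory.subinterval 0 p (by omega)).op σ

/-- The back `q`-face `σ|[v_p, …, v_(p+q)]` of a singular `(p + q)`-simplex. -/
noncomputable def backFace (p q : ℕ) (σ : SingularSimplex X (p + q)) : SingularSimplex X q :=
  (TopCat.toSSet.obj (TopCat.of X)).map (SimplexCategory.subinterval p q le_rfl).op σ

variable (X)

/-- The cup product of singular cochains,
`(a ∪ b)(σ) = a(σ|[v_0, …, v_p]) b(σ|[v_p, …, v_(p+q)])`. -/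
noncomputable def cochainCup (p q : ℕ) : SingularCochain R X p →ₗ[R] SingularCochain R X q →ₗ[R]
    SingularCochain R X (p + q) :=
  LinearMap.mk₂ R (fun a b σ => a (frontFace p q σ) * b (backFace p q σ))
    (fun a a' b => by funext σ; simp [add_mul])
    (fun c a b => by funext σ; simp [mul_assoc])
    (fun a b b' => by funext σ; simp [mul_add])
    (fun c a b => by funext σ; simp [mul_left_comm])

end Cohomology

section Faces

variable {X : Type u} [TopologicalSpace X]

theorem frontFace_one_one (σ : SingularSimplex X 2) :
    frontFace 1 1 σ = (TopCat.toSSet.obj (TopCat.of X)).δ 2 σ := by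
  have h : SimplexCategory.subinterval 0 1 (by omega : 0 + 1 ≤ 2) =
      SimplexCategory.δ (2 : Fin 3) := by
    ext i; fin_cases i <;> rfl
  exact congrArg (fun f => (TopCat.toSSet.obj (TopCat.of X)).map (Quiver.Hom.op f) σ) h

theorem backFace_one_one (σ : SingularSimplex X 2) :
    backFace 1 1 σ = (TopCat.toSSet.obj (TopCat.of X)).δ 0 σ := by
  have h : SimplexCategory.subinterval 1 1 (by omega : 1 + 1 ≤ 2) =
      SimplexCategory.δ (0 : Fin 3) := by
    ext i; fin_cases i <;> rfl
  exact congrArg (fun f => (TopCat.toSSet.obj (TopCat.of X)).map (Quiver.Hom.op f) σ) h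

/-- The simplicial identity `d_i d_(j+1) = d_j d_i` for `i ≤ j`, on elements. -/
theorem face_face (n : ℕ) (i j : Fin (n + 2)) (h : i ≤ j) (σ : SingularSimplex X (n + 2)) :
    (TopCat.toSSet.obj (TopCat.of X)).δ i ((TopCat.toSSet.obj (TopCat.of X)).δ j.succ σ) =
    (TopCat.toSSet.obj (TopCat.of X)).δ j ((TopCat.toSSet.obj (TopCat.of X)).δ i.castSucc σ) :=
  ConcreteCategory.congr_hom ((TopCat.toSSet.obj (TopCat.of X)).δ_comp_δ h) σ

end Faces

section Cup

variable (R : Type v) [CommRing R] (X : Type u) [TopologicalSpace X]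

theorem singularCoboundary_zero_apply (f : SingularCochain R X 0) (σ : SingularSimplex X 1) :
    singularCoboundary R X 0 f σ =
      f ((TopCat.toSSet.obj (TopCat.of X)).δ 0 σ) -
        f ((TopCat.toSSet.obj (TopCat.of X)).δ 1 σ) := by
  simp [singularCoboundary, Fin.sum_univ_succ, sub_eq_add_neg]

theorem singularCoboundary_one_apply (f : SingularCochain R X 1) (σ : SingularSimplex X 2) :
    singularCoboundary R X 1 f σ =
      f ((TopCat.toSSet.obj (TopCat.of X)).δ 0 σ) -
        f ((TopCat.toSSet.obj (TopCat.of X)).δ 1 σ) +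
        f ((TopCat.toSSet.obj (TopCat.of X)).δ 2 σ) := by
  simp [singularCoboundary, Fin.sum_univ_succ]
  ring

theorem singularCoboundary_two_apply (f : SingularCochain R X 2) (σ : SingularSimplex X 3) :
    singularCoboundary R X 2 f σ =
      f ((TopCat.toSSet.obj (TopCat.of X)).δ 0 σ) -
        f ((TopCat.toSSet.obj (TopCat.of X)).δ 1 σ) +
        f ((TopCat.toSSet.obj (TopCat.of X)).δ 2 σ) -
        f ((TopCat.toSSet.obj (TopCat.of X)).δ 3 σ) := by
  change ∑ i : Fin 4, (-1 : R) ^ (i : ℕ) *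
    f ((TopCat.toSSet.obj (TopCat.of X)).δ i σ) = _
  simp [Fin.sum_univ_four]
  ring

theorem cochainCup_one_one_apply (a b : SingularCochain R X 1) (σ : SingularSimplex X 2) :
    cochainCup R X 1 1 a b σ =
      a ((TopCat.toSSet.obj (TopCat.of X)).δ 2 σ) *
        b ((TopCat.toSSet.obj (TopCat.of X)).δ 0 σ) := by
  rw [← frontFace_one_one, ← backFace_one_one]
  rfl

variable {R X}

theorem cochainCup_mem_cocycles {a b : SingularCochain R X 1}
    (ha : a ∈ singularCocycles R X 1) (hb : b ∈ singularCocycles R X 1) :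
    cochainCup R X 1 1 a b ∈ singularCocycles R X 2 := by
  have ha' (τ : SingularSimplex X 2) := congrFun (LinearMap.mem_ker.mp ha) τ
  have hb' (τ : SingularSimplex X 2) := congrFun (LinearMap.mem_ker.mp hb) τ
  simp only [singularCoboundary_one_apply, Pi.zero_apply] at ha' hb'
  refine LinearMap.mem_ker.mpr (funext fun σ => (singularCoboundary_two_apply R X _ σ).trans ?_)
  rw [cochainCup_one_one_apply, cochainCup_one_one_apply, cochainCup_one_one_apply,
    cochainCup_one_one_apply]
  have h3 := ha' ((TopCat.toSSet.obj (TopCat.of X)).δ 3 σ)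
  have h0 := hb' ((TopCat.toSSet.obj (TopCat.of X)).δ 0 σ)
  have e1 : (TopCat.toSSet.obj (TopCat.of X)).δ 0 ((TopCat.toSSet.obj (TopCat.of X)).δ 1 σ) =
      (TopCat.toSSet.obj (TopCat.of X)).δ 0 ((TopCat.toSSet.obj (TopCat.of X)).δ 0 σ) :=
    face_face 1 0 0 le_rfl σ
  have e2 : (TopCat.toSSet.obj (TopCat.of X)).δ 0 ((TopCat.toSSet.obj (TopCat.of X)).δ 2 σ) =
      (TopCat.toSSet.obj (TopCat.of X)).δ 1 ((TopCat.toSSet.obj (TopCat.of X)).δ 0 σ) :=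
    face_face 1 0 1 (by decide) σ
  have e3 : (TopCat.toSSet.obj (TopCat.of X)).δ 0 ((TopCat.toSSet.obj (TopCat.of X)).δ 3 σ) =
      (TopCat.toSSet.obj (TopCat.of X)).δ 2 ((TopCat.toSSet.obj (TopCat.of X)).δ 0 σ) :=
    face_face 1 0 2 (by decide) σ
  have e5 : (TopCat.toSSet.obj (TopCat.of X)).δ 1 ((TopCat.toSSet.obj (TopCat.of X)).δ 3 σ) =
      (TopCat.toSSet.obj (TopCat.of X)).δ 2 ((TopCat.toSSet.obj (TopCat.of X)).δ 1 σ) :=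
    face_face 1 1 2 (by decide) σ
  have e6 : (TopCat.toSSet.obj (TopCat.of X)).δ 2 ((TopCat.toSSet.obj (TopCat.of X)).δ 3 σ) =
      (TopCat.toSSet.obj (TopCat.of X)).δ 2 ((TopCat.toSSet.obj (TopCat.of X)).δ 2 σ) :=
    face_face 1 2 2 le_rfl σ
  rw [e3, e5, e6] at h3
  rw [e1, e2, e3, e6]
  change _ = (0 : R)
  linear_combination
    b ((TopCat.toSSet.obj (TopCat.of X)).δ 0 ((TopCat.toSSet.obj (TopCat.of X)).δ 0 σ)) * h3 -
    a ((TopCat.toSSet.obj (TopCat.of X)).δ 2 ((TopCat.toSSet.obj (TopCat.of X)).δ 2 σ)) * h0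

theorem cochainCup_coboundary_left {a b : SingularCochain R X 1}
    (ha : a ∈ singularCoboundaries R X 1) (hb : b ∈ singularCocycles R X 1) :
    cochainCup R X 1 1 a b ∈ singularCoboundaries R X 2 := by
  obtain ⟨f, rfl⟩ := LinearMap.mem_range.mp ha
  refine LinearMap.mem_range.mpr
    ⟨fun τ => f ((TopCat.toSSet.obj (TopCat.of X)).δ 1 τ) * b τ, funext fun σ => ?_⟩
  have h := congrFun (LinearMap.mem_ker.mp hb) σ
  rw [singularCoboundary_one_apply, Pi.zero_apply] at h
  refine (singularCoboundary_one_apply R X _ σ).trans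
    (Eq.trans ?_ (cochainCup_one_one_apply R X _ b σ).symm)
  rw [singularCoboundary_zero_apply]
  have e1 : (TopCat.toSSet.obj (TopCat.of X)).δ 0 ((TopCat.toSSet.obj (TopCat.of X)).δ 2 σ) =
      (TopCat.toSSet.obj (TopCat.of X)).δ 1 ((TopCat.toSSet.obj (TopCat.of X)).δ 0 σ) :=
    face_face 0 0 1 (by decide) σ
  have e2 : (TopCat.toSSet.obj (TopCat.of X)).δ 1 ((TopCat.toSSet.obj (TopCat.of X)).δ 2 σ) =
      (TopCat.toSSet.obj (TopCat.of X)).δ 1 ((TopCat.toSSet.obj (TopCat.of X)).δ 1 σ) :=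
    face_face 0 1 1 le_rfl σ
  rw [e1, e2]
  linear_combination
    f ((TopCat.toSSet.obj (TopCat.of X)).δ 1 ((TopCat.toSSet.obj (TopCat.of X)).δ 1 σ)) * h

theorem cochainCup_coboundary_right {a b : SingularCochain R X 1}
    (ha : a ∈ singularCocycles R X 1) (hb : b ∈ singularCoboundaries R X 1) :
    cochainCup R X 1 1 a b ∈ singularCoboundaries R X 2 := by
  obtain ⟨f, rfl⟩ := LinearMap.mem_range.mp hb
  refine LinearMap.mem_range.mpr
    ⟨fun τ => -(a τ * f ((TopCat.toSSet.obj (TopCat.of X)).δ 0 τ)), funext fun σ => ?_⟩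
  have h := congrFun (LinearMap.mem_ker.mp ha) σ
  rw [singularCoboundary_one_apply, Pi.zero_apply] at h
  refine (singularCoboundary_one_apply R X _ σ).trans
    (Eq.trans ?_ (cochainCup_one_one_apply R X a _ σ).symm)
  rw [singularCoboundary_zero_apply]
  have e1 : (TopCat.toSSet.obj (TopCat.of X)).δ 0 ((TopCat.toSSet.obj (TopCat.of X)).δ 2 σ) =
      (TopCat.toSSet.obj (TopCat.of X)).δ 1 ((TopCat.toSSet.obj (TopCat.of X)).δ 0 σ) :=
    face_face 0 0 1 (by decide) σ
  have e2 : (TopCat.toSSet.obj (TopCat.of X)).δ 0 ((TopCat.toSSet.obj (TopCat.of X)).δ 1 σ) =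
      (TopCat.toSSet.obj (TopCat.of X)).δ 0 ((TopCat.toSSet.obj (TopCat.of X)).δ 0 σ) :=
    face_face 0 0 0 le_rfl σ
  rw [e1, e2]
  linear_combination
    -f ((TopCat.toSSet.obj (TopCat.of X)).δ 0 ((TopCat.toSSet.obj (TopCat.of X)).δ 0 σ)) * h

variable (R X)

/-- The cup product `H^1(X; R) × H^1(X; R) → H^2(X; R)`, `([a], [b]) ↦ [a ∪ b]`. -/
noncomputable def cupProduct : SingularCohomology R X 1 →ₗ[R] SingularCohomology R X 1 →ₗ[R]
    SingularCohomology R X 2 :=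
  let c : singularCocycles R X 1 →ₗ[R] singularCocycles R X 1 →ₗ[R] SingularCohomology R X 2 :=
    LinearMap.mk₂ R
      (fun a b => Submodule.Quotient.mk
        ⟨cochainCup R X 1 1 a b, cochainCup_mem_cocycles a.2 b.2⟩)
      (fun a a' b => congrArg Submodule.Quotient.mk (Subtype.ext (by simp)))
      (fun r a b => congrArg Submodule.Quotient.mk (Subtype.ext (by simp)))
      (fun a b b' => congrArg Submodule.Quotient.mk (Subtype.ext (by simp)))
      (fun r a b => congrArg Submodule.Quotient.mk (Subtype.ext (by simp)))
  Submodule.liftQ _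
    (LinearMap.flip (Submodule.liftQ _ (LinearMap.flip c) (fun b hb => by
      refine LinearMap.mem_ker.mpr (LinearMap.ext fun a => ?_)
      exact (Submodule.Quotient.mk_eq_zero _).mpr (cochainCup_coboundary_right a.2 hb))))
    (fun a ha => by
      refine LinearMap.mem_ker.mpr (LinearMap.ext fun b => ?_)
      obtain ⟨b, rfl⟩ := Submodule.Quotient.mk_surjective _ b
      exact (Submodule.Quotient.mk_eq_zero _).mpr (cochainCup_coboundary_left ha b.2))

theorem cupProduct_mk (a b : singularCocycles R X 1) :
    cupProduct R X (Submodule.Quotient.mk a) (Submodule.Quotient.mk b) =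
      Submodule.Quotient.mk ⟨cochainCup R X 1 1 a b, cochainCup_mem_cocycles a.2 b.2⟩ :=
  rfl

/-- The subspace of `H^2(X; ℤ/2)` spanned by the image of the cup product
`H^1(X; ℤ/2) × H^1(X; ℤ/2) → H^2(X; ℤ/2)`. -/
noncomputable def cupSpan : Submodule (ZMod 2) (SingularCohomology (ZMod 2) X 2) :=
  Submodule.span (ZMod 2)
    (Set.range fun x : SingularCohomology (ZMod 2) X 1 × SingularCohomology (ZMod 2) X 1 =>
      cupProduct (ZMod 2) X x.1 x.2)

end Cup

/-! ### The mod-2 lower central series -/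

section Sharp

variable {G : Type u} [Group G]

/-- For a subgroup `N` of `G`, the subgroup `G # N` of `G` generated by all the elements
`g a g⁻¹ a⁻¹ b²` with `g ∈ G` and `a, b ∈ N`. -/
def sharp (N : Subgroup G) : Subgroup G :=
  Subgroup.closure {x | ∃ g : G, ∃ a ∈ N, ∃ b ∈ N, x = g * a * g⁻¹ * a⁻¹ * b ^ 2}

theorem commutator_mem_sharp {N : Subgroup G} (g : G) {a : G} (ha : a ∈ N) :
    g * a * g⁻¹ * a⁻¹ ∈ sharp N :=
  Subgroup.subset_closure ⟨g, a, ha, 1, N.one_mem, by simp⟩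

theorem sq_mem_sharp {N : Subgroup G} {b : G} (hb : b ∈ N) : b ^ 2 ∈ sharp N :=
  Subgroup.subset_closure ⟨1, 1, N.one_mem, b, hb, by simp⟩

instance sharp_subgroupOf_normal (N : Subgroup G) : ((sharp N).subgroupOf N).Normal where
  conj_mem a ha g := by
    rw [Subgroup.mem_subgroupOf] at ha ⊢
    have h := (sharp N).mul_mem (commutator_mem_sharp (g : G) a.2) ha
    simpa [mul_assoc] using h

instance sharpQuotientCommGroup (N : Subgroup G) : CommGroup (N ⧸ (sharp N).subgroupOf N) where
  __ := QuotientGroup.Quotient.group ((sharp N).subgroupOf N)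
  mul_comm x y := by
    induction x using QuotientGroup.induction_on with | _ a =>
    induction y using QuotientGroup.induction_on with | _ b =>
    refine QuotientGroup.eq.mpr ?_
    rw [Subgroup.mem_subgroupOf]
    have h := commutator_mem_sharp ((b : G)⁻¹) (N.inv_mem a.2)
    simpa [mul_assoc] using h

/-- The `ℤ/2`-vector space structure on `N / (G # N)`, written additively. -/
instance sharpQuotientModule (N : Subgroup G) :
    Module (ZMod 2) (Additive (N ⧸ (sharp N).subgroupOf N)) :=
  AddCommGroup.zmodModule (n := 2) fun x => by
    rw [two_nsmul]
    change x.toMul * x.toMul = 1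
    induction x.toMul using QuotientGroup.induction_on with | _ a =>
    refine (QuotientGroup.eq_one_iff (a * a)).mpr ?_
    rw [Subgroup.mem_subgroupOf]
    simpa [pow_two] using sq_mem_sharp a.2

variable (G)

/-- `Γ_0 = Γ` and `Γ_(d+1) = Γ # Γ_d`. -/
def modTwoSeries (d : ℕ) : Subgroup G :=
  match d with
  | 0 => ⊤
  | k + 1 => sharp (modTwoSeries k)

/-- The quotient `Γ_d / Γ_(d+1)`, written additively. -/
abbrev ModTwoLayer (d : ℕ) : Type u :=
  Additive (modTwoSeries G d ⧸ (sharp (modTwoSeries G d)).subgroupOf (modTwoSeries G d))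

end Sharp

/-! ### Aspherical spaces and regular coverings -/

/-- A space is aspherical if it is path connected and its homotopy groups `π_n` vanish
for all `n ≥ 2`. -/
def IsAspherical (X : Type u) [TopologicalSpace X] : Prop :=
  PathConnectedSpace X ∧ ∀ n : ℕ, 2 ≤ n → ∀ x : X, Subsingleton (HomotopyGroup.Pi n X x)

section Covering

variable {E : Type v} {X : Type u} [TopologicalSpace E] [TopologicalSpace X]

/-- The group of covering transformations of `p : E → X`. -/
def deckGroup (p : E → X) : Subgroup (E ≃ₜ E) where
  carrier := {h | ∀ e, p (h e) = p e}
  mul_mem' {h k} hh hk e := (hh (k e)).trans (hk e)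
  one_mem' _ := rfl
  inv_mem' {h} hh e := by
    have := hh (h⁻¹ e)
    rw [← this]
    exact congrArg p (h.apply_symm_apply e)

/-- `p : E → X` is a regular covering: `E` is connected, `p` is a surjective covering map, and
the group of covering transformations acts transitively on every fibre. -/
structure IsRegularCovering (p : E → X) : Prop where
  connected : ConnectedSpace E
  isCoveringMap : IsCoveringMap p
  surjective : Function.Surjective p
  transitive : ∀ e e' : E, p e = p e' → ∃ h ∈ deckGroup p, h e = e'

end Covering

/-! Homomorphisms `Γ → ℤ/2` are the same as classes in `H^1(M; ℤ/2)`, so both claims become counts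
inside the group. Fix a basis `x_1, …, x_r` of these homomorphisms. Coefficients `u` on unordered
pairs, diagonal included, define a bilinear cochain `c_u = ∑ u_{ij} x_i ⊗ x_j` on `Γ`. Passing
between singular edges and group elements shows that `∑ u_{ij} x_i ∪ x_j` vanishes in `H^2(M; ℤ/2)`
exactly when `c_u` is the coboundary of a function `f : Γ → ℤ/2` (`ker_cupCombination`). The cup
product is symmetric mod 2, so these combinations fill its span, and the space of such `u`
(`boundingCoeffs`) has dimension `r(r+1)/2 - t`.

The central object is the space `T` of pairs `(u, f)` (`twistedHoms`). Its fibre over `u = 0` is the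
space of homomorphisms, so `dim T = r(r+1)/2 - t + r`. Each `f` is additive on `Γ_1` and kills
`Γ_2`, so it restricts to a functional on `Γ_1/Γ_2`. Since `f(g²) = c_u(g, g)`, and this quadratic
form determines `u`, the kernel of the restriction is again the fibre over `u = 0`. The restriction
is onto: for a functional `φ`, the map `g ↦ φ(g²)` is a quadratic form in the `x_i`, hence equals
`c_u(g, g)` for some `u` (`exists_quadCochain_diag`), and the central extension of `Γ` by `ℤ/2` with
cocycle `c_u` splits compatibly with `φ` (`exists_coboundary_extending`). This gives (1).

For (2), the fundamental group of the covering is the kernel `N` of a surjection `Γ → (ℤ/2)^m`.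
Extend its coordinates to a basis with `k = r - m` further members. If `u` vanishes on the pairs
within this second block, which costs at most `k(k+1)/2` conditions, then `f` restricts to a
homomorphism on `N`. Squares lie in `N`, so the kernel of this restriction has `u = 0` and consists
of homomorphisms vanishing on `N`, a space of dimension at most `m`. Hence `dim Hom(N, ℤ/2) ≥ dim T
- k(k+1)/2 - m` (`finrank_modTwoHoms_ker`), which is the stated bound.

The topological input is the duality of `H_1` with homomorphisms of the fundamental group, the
finite generation of that group, and its relation to the deck group. -/

/-! ### Homomorphisms to `ℤ/2` and quadratic cochains on groups -/

section ModTwoHoms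

variable {G : Type*} [Group G]

/-- The homomorphisms from `G` to `ℤ/2`, as a subspace of the space of functions. -/
def modTwoHoms (G : Type*) [Group G] : Submodule (ZMod 2) (G → ZMod 2) where
  carrier := {f | ∀ g h, f (g * h) = f g + f h}
  add_mem' {a b} ha hb g h := by
    simp only [Pi.add_apply, ha g h, hb g h]
    ring
  zero_mem' g h := by simp
  smul_mem' c f hf g h := by simp [hf g h, mul_add]

theorem mem_modTwoHoms {f : G → ZMod 2} :
    f ∈ modTwoHoms G ↔ ∀ g h, f (g * h) = f g + f h := Iff.rfl

theorem modTwoHoms_one {f : G → ZMod 2} (hf : f ∈ modTwoHoms G) : f 1 = 0 := by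
  simpa using hf 1 1

theorem modTwoHoms_inv {f : G → ZMod 2} (hf : f ∈ modTwoHoms G) (g : G) : f g⁻¹ = f g := by
  have h := hf g g⁻¹
  rw [mul_inv_cancel, modTwoHoms_one hf] at h
  exact (CharTwo.add_eq_zero.mp h.symm).symm

theorem modTwoHoms_sq {f : G → ZMod 2} (hf : f ∈ modTwoHoms G) (g : G) : f (g ^ 2) = 0 := by
  rw [pow_two, hf g g]
  exact CharTwo.add_self_eq_zero _

theorem zmod_two_smul_eq {V : Type*} [AddCommGroup V] [Module (ZMod 2) V] (c : ZMod 2) (v : V) :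
    c • v = 0 ∨ c • v = v := by
  fin_cases c
  · exact Or.inl (zero_smul _ v)
  · exact Or.inr (one_smul _ v)

/-- A linearly independent family of homomorphisms to `ℤ/2` has a dual family. -/
theorem exists_dual_family {ι : Type*} [Fintype ι] [DecidableEq ι] {x : ι → modTwoHoms G}
    (hx : LinearIndependent (ZMod 2) x) :
    ∃ e : ι → G, ∀ i j, (x i : G → ZMod 2) (e j) = if i = j then 1 else 0 := by
  -- The simultaneous values of the family form a subspace: sums come from products in `G`, and the
  -- only scalars are `0` and `1`. A functional killing a proper subspace would be a linear relation
  -- among the `x i`.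
  let W : Submodule (ZMod 2) (ι → ZMod 2) :=
    { carrier := Set.range fun g i => (x i : G → ZMod 2) g
      add_mem' := by
        rintro _ _ ⟨g, rfl⟩ ⟨h, rfl⟩
        exact ⟨g * h, funext fun i => (x i).2 g h⟩
      zero_mem' := ⟨1, funext fun i => modTwoHoms_one (x i).2⟩
      smul_mem' := by
        rintro c _ ⟨g, rfl⟩
        rcases zmod_two_smul_eq c (fun i => (x i : G → ZMod 2) g) with h | h
        · exact ⟨1, by rw [h]; exact funext fun i => modTwoHoms_one (x i).2⟩
        · exact ⟨g, h.symm⟩ }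
  have hW : W = ⊤ := by
    by_contra hne
    obtain ⟨φ, hφ, hle⟩ := W.exists_le_ker_of_lt_top (lt_top_iff_ne_top.mpr hne)
    have hφ' (v : ι → ZMod 2) : φ v = ∑ i, v i * φ (Pi.single i 1) := by
      conv_lhs => rw [← Finset.univ_sum_single v, map_sum]
      refine Finset.sum_congr rfl fun i _ => ?_
      rw [← smul_eq_mul, ← map_smul, ← Pi.single_smul', smul_eq_mul, mul_one]
    refine hφ ?_
    have hz : ∑ i, φ (Pi.single i 1) • x i = 0 := by
      refine Subtype.ext (funext fun g => ?_)
      have h : φ (fun i => (x i : G → ZMod 2) g) = 0 := hle ⟨g, rfl⟩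
      rw [hφ'] at h
      simpa [mul_comm] using h
    have h0 := Fintype.linearIndependent_iff.mp hx _ hz
    refine LinearMap.ext fun v => ?_
    rw [hφ' v]
    simp [h0]
  have hmem (j : ι) : (fun i => if i = j then (1 : ZMod 2) else 0) ∈ W := hW ▸ trivial
  choose e he using hmem
  exact ⟨e, fun i j => congrFun (he j) i⟩

/-- A homomorphism to `ℤ/2` vanishing on a family dual to a basis is zero. -/
theorem eq_zero_of_dual_family {ι : Type*} [Fintype ι] [DecidableEq ι]
    (x : Module.Basis ι (ZMod 2) (modTwoHoms G)) {e : ι → G}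
    (he : ∀ i j, (x i : G → ZMod 2) (e j) = if i = j then 1 else 0)
    {f : G → ZMod 2} (hf : f ∈ modTwoHoms G) (h0 : ∀ j, f (e j) = 0) : f = 0 := by
  have hsum := x.sum_repr ⟨f, hf⟩
  have hc (j : ι) : x.repr ⟨f, hf⟩ j = 0 := by
    have h := congrFun (congrArg Subtype.val hsum) (e j)
    simp only [AddSubmonoidClass.coe_finsetSum, Submodule.coe_smul, Finset.sum_apply,
      Pi.smul_apply, he, smul_eq_mul, mul_ite, mul_one, mul_zero, Finset.sum_ite_eq',
      Finset.mem_univ, if_true] at h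
    rw [h, h0 j]
  simpa [hc] using (congrArg Subtype.val hsum).symm

/-- The bilinear cochain `∑ u_{ij} x_i ⊗ x_j`, summed over unordered pairs
(each with a chosen order). -/
noncomputable def quadCochain {ι : Type*} [Fintype ι] [DecidableEq ι] {Y : Type*}
    (x : ι → Y → ZMod 2) (u : Sym2 ι → ZMod 2) (g h : Y) : ZMod 2 :=
  ∑ s : Sym2 ι, u s * (x (Quot.out s).1 g * x (Quot.out s).2 h)

theorem sym2_mk_out {α : Type*} (s : Sym2 α) : s((Quot.out s).1, (Quot.out s).2) = s := Quot.out_eq s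

/-! ### Quadratic cochains and their primitives -/

section Quad

variable {ι : Type*} [Fintype ι] [DecidableEq ι] {Y : Type*}

theorem quadCochain_add (x : ι → Y → ZMod 2) (u w : Sym2 ι → ZMod 2) (g h : Y) :
    quadCochain x (u + w) g h = quadCochain x u g h + quadCochain x w g h := by
  simp [quadCochain, add_mul, Finset.sum_add_distrib]

theorem quadCochain_smul (x : ι → Y → ZMod 2) (c : ZMod 2) (u : Sym2 ι → ZMod 2) (g h : Y) :
    quadCochain x (c • u) g h = c * quadCochain x u g h := by
  simp [quadCochain, Finset.mul_sum, mul_assoc]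

theorem quadCochain_zero (x : ι → Y → ZMod 2) (g h : Y) : quadCochain x 0 g h = 0 := by
  simp [quadCochain]

theorem quadCochain_mul_left {x : ι → modTwoHoms G} (u : Sym2 ι → ZMod 2) (g g' h : G) :
    quadCochain (fun i => (x i : G → ZMod 2)) u (g * g') h =
      quadCochain (fun i => (x i : G → ZMod 2)) u g h +
      quadCochain (fun i => (x i : G → ZMod 2)) u g' h := by
  simp only [quadCochain, ← Finset.sum_add_distrib]
  refine Finset.sum_congr rfl fun s _ => ?_
  rw [(x _).2 g g']
  ring

theorem quadCochain_mul_right {x : ι → modTwoHoms G} (u : Sym2 ι → ZMod 2) (g h h' : G) :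
    quadCochain (fun i => (x i : G → ZMod 2)) u g (h * h') =
      quadCochain (fun i => (x i : G → ZMod 2)) u g h +
      quadCochain (fun i => (x i : G → ZMod 2)) u g h' := by
  simp only [quadCochain, ← Finset.sum_add_distrib]
  refine Finset.sum_congr rfl fun s _ => ?_
  rw [(x _).2 h h']
  ring

/-- The values of the symmetrised cochain on a dual family. -/
theorem quadCochain_polar_dual {x : ι → Y → ZMod 2} {e : ι → Y}
    (he : ∀ i j, x i (e j) = if i = j then 1 else 0) (u : Sym2 ι → ZMod 2) {i j : ι}
    (hij : i ≠ j) :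
    quadCochain x u (e i) (e j) + quadCochain x u (e j) (e i) = u s(i, j) := by
  -- The chosen representative of `s(i, j)` may have either order, so only the symmetrised value is
  -- determined.
  rw [quadCochain, quadCochain, ← Finset.sum_add_distrib, Finset.sum_eq_single s(i, j)]
  · have h := sym2_mk_out s(i, j)
    rw [Sym2.eq_iff] at h
    rcases h with ⟨h1, h2⟩ | ⟨h1, h2⟩ <;> simp [h1, h2, he, hij, hij.symm]
  · intro s _ hs
    have h := sym2_mk_out s
    generalize (Quot.out s).1 = a at *
    generalize (Quot.out s).2 = b at *
    subst h
    rw [Ne, Sym2.eq_iff] at hs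
    simp only [he]
    split_ifs <;> simp_all
  · simp

theorem quadCochain_diag_dual {x : ι → Y → ZMod 2} {e : ι → Y}
    (he : ∀ i j, x i (e j) = if i = j then 1 else 0) (u : Sym2 ι → ZMod 2) (i : ι) :
    quadCochain x u (e i) (e i) = u s(i, i) := by
  rw [quadCochain, Finset.sum_eq_single s(i, i)]
  · have h := sym2_mk_out s(i, i)
    rw [Sym2.eq_iff] at h
    rcases h with ⟨h1, h2⟩ | ⟨h1, h2⟩ <;> simp [h1, h2, he]
  · intro s _ hs
    have h := sym2_mk_out s
    generalize (Quot.out s).1 = a at *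
    generalize (Quot.out s).2 = b at *
    subst h
    rw [Ne, Sym2.eq_iff] at hs
    simp only [he]
    split_ifs <;> simp_all
  · simp

/-- A quadratic cochain that vanishes on the diagonal has zero coefficients. -/
theorem eq_zero_of_quadCochain_diag {x : ι → modTwoHoms G} (hx : LinearIndependent (ZMod 2) x)
    {u : Sym2 ι → ZMod 2} (h : ∀ g, quadCochain (fun i => (x i : G → ZMod 2)) u g g = 0) :
    u = 0 := by
  obtain ⟨e, he⟩ := exists_dual_family hx
  funext s
  induction s using Sym2.ind with | _ i j =>
  by_cases hij : i = j
  · subst hij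
    rw [← quadCochain_diag_dual (x := fun i => (x i : G → ZMod 2)) he u i, h]
    rfl
  · rw [← quadCochain_polar_dual (x := fun i => (x i : G → ZMod 2)) he u hij]
    -- Polarisation: at a product the diagonal terms vanish and the symmetrised value remains.
    have h2 := h (e i * e j)
    rw [quadCochain_mul_left, quadCochain_mul_right, quadCochain_mul_right, h, h, zero_add,
      add_zero] at h2
    exact h2

/-- The pairs of a coefficient family `u` and a function `f` on `G` whose coboundary is the
bilinear cochain of `u`. -/
def twistedHoms (x : ι → modTwoHoms G) :
    Submodule (ZMod 2) ((Sym2 ι → ZMod 2) × (G → ZMod 2)) where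
  -- The arguments of the cochain are swapped because a product `g * h` in the fundamental group
  -- runs through `h` first, so `h` is the front edge in the cup product.
  carrier := {p | ∀ g h, p.2 (g * h) =
    p.2 g + p.2 h + quadCochain (fun i => (x i : G → ZMod 2)) p.1 h g}
  add_mem' {a b} ha hb g h := by
    simp only [Prod.snd_add, Prod.fst_add, Pi.add_apply, ha g h, hb g h, quadCochain_add]
    ring
  zero_mem' g h := by simp [quadCochain_zero]
  smul_mem' c p hp g h := by
    simp only [Prod.smul_fst, Prod.smul_snd, Pi.smul_apply, hp g h, quadCochain_smul, smul_eq_mul]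
    ring

theorem mem_twistedHoms {x : ι → modTwoHoms G} {p : (Sym2 ι → ZMod 2) × (G → ZMod 2)} :
    p ∈ twistedHoms x ↔ ∀ g h, p.2 (g * h) =
      p.2 g + p.2 h + quadCochain (fun i => (x i : G → ZMod 2)) p.1 h g := Iff.rfl

/-- Through squares, a primitive remembers its quadratic form. This is why restriction to a subgroup
containing all squares loses no coefficient. -/
theorem twistedHoms_sq {x : ι → modTwoHoms G} {p : (Sym2 ι → ZMod 2) × (G → ZMod 2)}
    (hp : p ∈ twistedHoms x) (g : G) :
    p.2 (g ^ 2) = quadCochain (fun i => (x i : G → ZMod 2)) p.1 g g := by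
  rw [pow_two, hp g g, CharTwo.add_self_eq_zero, zero_add]

theorem zero_prod_mem_twistedHoms {x : ι → modTwoHoms G} {f : G → ZMod 2} :
    ((0 : Sym2 ι → ZMod 2), f) ∈ twistedHoms x ↔ f ∈ modTwoHoms G := by
  simp [mem_twistedHoms, mem_modTwoHoms, quadCochain_zero]

/-- The coefficient families whose bilinear cochain is a coboundary on `G`. -/
noncomputable def boundingCoeffs (x : ι → modTwoHoms G) : Submodule (ZMod 2) (Sym2 ι → ZMod 2) :=
  (twistedHoms x).map (LinearMap.fst _ _ _)

theorem mem_boundingCoeffs {x : ι → modTwoHoms G} {u : Sym2 ι → ZMod 2} :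
    u ∈ boundingCoeffs x ↔ ∃ f : G → ZMod 2, ∀ g h, f (g * h) =
      f g + f h + quadCochain (fun i => (x i : G → ZMod 2)) u h g := by
  constructor
  · rintro ⟨⟨u', f⟩, hp, rfl⟩
    exact ⟨f, hp⟩
  · rintro ⟨f, hf⟩
    exact ⟨(u, f), hf, rfl⟩

/-- The projection of `twistedHoms` to the coefficients. -/
noncomputable def twistedFst (x : ι → modTwoHoms G) : twistedHoms x →ₗ[ZMod 2] (Sym2 ι → ZMod 2) :=
  (LinearMap.fst _ _ _) ∘ₗ (twistedHoms x).subtype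

theorem range_twistedFst (x : ι → modTwoHoms G) :
    LinearMap.range (twistedFst x) = boundingCoeffs x := by
  rw [twistedFst, LinearMap.range_comp, Submodule.range_subtype]
  rfl

/-- The kernel of the projection to the coefficients consists of the homomorphisms. -/
noncomputable def kerTwistedFstEquiv (x : ι → modTwoHoms G) :
    LinearMap.ker (twistedFst x) ≃ₗ[ZMod 2] modTwoHoms G where
  toFun p := ⟨p.1.1.2, by
    have h0 : p.1.1.1 = 0 := p.2
    rw [← zero_prod_mem_twistedHoms (x := x), ← h0]
    exact p.1.2⟩
  map_add' _ _ := rfl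
  map_smul' _ _ := rfl
  invFun f := ⟨⟨(0, f), zero_prod_mem_twistedHoms.mpr f.2⟩, rfl⟩
  left_inv p := Subtype.ext (Subtype.ext (Prod.ext (Eq.symm p.2) rfl))
  right_inv _ := rfl

theorem finite_twistedHoms (x : ι → modTwoHoms G) [Module.Finite (ZMod 2) (modTwoHoms G)] :
    Module.Finite (ZMod 2) (twistedHoms x) := by
  have : Module.Finite (ZMod 2) (LinearMap.ker (twistedFst x)) :=
    Module.Finite.equiv (kerTwistedFstEquiv x).symm
  have : Module.Finite (ZMod 2) (twistedHoms x ⧸ LinearMap.ker (twistedFst x)) :=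
    Module.Finite.equiv (twistedFst x).quotKerEquivRange.symm
  exact Module.Finite.of_submodule_quotient (LinearMap.ker (twistedFst x))

theorem finrank_twistedHoms (x : ι → modTwoHoms G) [Module.Finite (ZMod 2) (modTwoHoms G)] :
    Module.finrank (ZMod 2) (twistedHoms x) = Module.finrank (ZMod 2) (boundingCoeffs x) +
      Module.finrank (ZMod 2) (modTwoHoms G) := by
  have := finite_twistedHoms x
  rw [← (twistedFst x).finrank_range_add_finrank_ker, range_twistedFst,
    (kerTwistedFstEquiv x).finrank_eq]

end Quad

end ModTwoHoms

/-! ### The layers of the mod-2 lower central series -/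

section Layers

variable {G : Type*} [Group G]

theorem sharp_top_eq_closure_sq :
    sharp (⊤ : Subgroup G) = Subgroup.closure (Set.range fun g : G => g ^ 2) := by
  apply le_antisymm
  · refine (Subgroup.closure_le _).mpr ?_
    rintro _ ⟨g, a, -, b, -, rfl⟩
    have h (k : G) : k ^ 2 ∈ Subgroup.closure (Set.range fun g : G => g ^ 2) :=
      Subgroup.subset_closure ⟨k, rfl⟩
    -- A commutator is a product of three squares.
    have e : g * a * g⁻¹ * a⁻¹ * b ^ 2 = (g * a) ^ 2 * (a⁻¹ * g⁻¹ * a) ^ 2 * (a⁻¹) ^ 2 * b ^ 2 := by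
      simp only [pow_two]
      group
    rw [e]
    exact mul_mem (mul_mem (mul_mem (h _) (h _)) (h _)) (h _)
  · refine (Subgroup.closure_le _).mpr ?_
    rintro _ ⟨g, rfl⟩
    exact sq_mem_sharp (Subgroup.mem_top g)

theorem modTwoHoms_sharp_top {f : G → ZMod 2} (hf : f ∈ modTwoHoms G) {a : G}
    (ha : a ∈ sharp (⊤ : Subgroup G)) : f a = 0 := by
  rw [sharp_top_eq_closure_sq] at ha
  induction ha using Subgroup.closure_induction with
  | mem x hx =>
    obtain ⟨g, rfl⟩ := hx
    exact modTwoHoms_sq hf g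
  | one => exact modTwoHoms_one hf
  | mul x y _ _ hx hy => rw [hf, hx, hy, add_zero]
  | inv x _ hx => rw [modTwoHoms_inv hf, hx]

theorem sharp_mono_top {N : Subgroup G} : sharp N ≤ sharp (⊤ : Subgroup G) := by
  refine Subgroup.closure_mono ?_
  rintro _ ⟨g, a, -, b, -, rfl⟩
  exact ⟨g, a, trivial, b, trivial, rfl⟩

/-- The homomorphisms `N → ℤ/2` that vanish on `G # N`. -/
def layerHoms (N : Subgroup G) : Submodule (ZMod 2) (N → ZMod 2) where
  carrier := {φ | φ ∈ modTwoHoms N ∧ ∀ a : N, (a : G) ∈ sharp N → φ a = 0}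
  add_mem' {φ ψ} hφ hψ := ⟨add_mem hφ.1 hψ.1, fun a ha => by simp [hφ.2 a ha, hψ.2 a ha]⟩
  zero_mem' := ⟨zero_mem _, fun _ _ => rfl⟩
  smul_mem' c φ hφ := ⟨Submodule.smul_mem _ c hφ.1, fun a ha => by simp [hφ.2 a ha]⟩

/-- The dual space of `N / (G # N)`. -/
noncomputable def dualLayerEquiv {G : Type u} [Group G] (N : Subgroup G) :
    Module.Dual (ZMod 2) (Additive (N ⧸ (sharp N).subgroupOf N)) ≃ₗ[ZMod 2] layerHoms N where
  toFun l := ⟨fun a => l (Additive.ofMul (QuotientGroup.mk a)), fun a b => by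
      rw [← map_add]
      rfl, fun a ha => by
      have h : (QuotientGroup.mk a : N ⧸ (sharp N).subgroupOf N) = 1 :=
        (QuotientGroup.eq_one_iff a).mpr ha
      exact (congrArg (fun z => l (Additive.ofMul z)) h).trans (map_zero l)⟩
  map_add' _ _ := rfl
  map_smul' _ _ := rfl
  invFun φ := AddMonoidHom.toZModLinearMap 2 <| MonoidHom.toAdditiveLeft <|
    QuotientGroup.lift ((sharp N).subgroupOf N)
      (MonoidHom.mk' (fun a => Multiplicative.ofAdd (φ.1 a)) fun a b =>
        congrArg Multiplicative.ofAdd (φ.2.1 a b))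
      fun a ha => congrArg Multiplicative.ofAdd (φ.2.2 a ha)
  left_inv l := by
    refine LinearMap.ext fun z => ?_
    induction z using Additive.rec with | _ z =>
    induction z using QuotientGroup.induction_on with | _ a => rfl
  right_inv _ := rfl

/-- Homomorphisms to `ℤ/2` separate the points of `G / (G # G)`. -/
theorem exists_modTwoHom_ne_zero {G : Type u} [Group G] {z : G}
    (hz : z ∉ sharp (⊤ : Subgroup G)) : ∃ f ∈ modTwoHoms G, f z ≠ 0 := by
  by_contra! hcon
  refine hz ?_
  let z' : (⊤ : Subgroup G) := ⟨z, trivial⟩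
  -- The quotient is a vector space over `ℤ/2`, so an element killed by every functional is zero.
  have h : Additive.ofMul
      (QuotientGroup.mk z' : (⊤ : Subgroup G) ⧸ (sharp (⊤ : Subgroup G)).subgroupOf ⊤) = 0 := by
    rw [← Module.forall_dual_apply_eq_zero_iff (ZMod 2)]
    intro l
    exact hcon (fun g => (dualLayerEquiv ⊤ l).1 ⟨g, trivial⟩) fun a b =>
      (dualLayerEquiv ⊤ l).2.1 ⟨a, trivial⟩ ⟨b, trivial⟩
  exact (QuotientGroup.eq_one_iff z').mp h

/-! ### The dual of the first layer, by restriction of primitives -/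

section Twisted

variable {ι : Type*} [Fintype ι] [DecidableEq ι]

theorem quadCochain_sharp_left (x : ι → modTwoHoms G) (u : Sym2 ι → ZMod 2) {g : G}
    (hg : g ∈ sharp (⊤ : Subgroup G)) (h : G) :
    quadCochain (fun i => (x i : G → ZMod 2)) u g h = 0 := by
  refine Finset.sum_eq_zero fun s _ => ?_
  simp [modTwoHoms_sharp_top (x _).2 hg]

theorem quadCochain_sharp_right (x : ι → modTwoHoms G) (u : Sym2 ι → ZMod 2) (g : G) {h : G}
    (hh : h ∈ sharp (⊤ : Subgroup G)) :
    quadCochain (fun i => (x i : G → ZMod 2)) u g h = 0 := by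
  refine Finset.sum_eq_zero fun s _ => ?_
  simp [modTwoHoms_sharp_top (x _).2 hh]

/-- All `x i` vanish on `sharp ⊤`, so the twisting term disappears once one factor lies there. Hence
`p.2` is additive on `sharp ⊤`, invariant under conjugation by `G`, and zero on the generators `g a
g⁻¹ a⁻¹ b²`. -/
theorem twistedHoms_restrict_mem {x : ι → modTwoHoms G}
    {p : (Sym2 ι → ZMod 2) × (G → ZMod 2)} (hp : p ∈ twistedHoms x) :
    (fun a : sharp (⊤ : Subgroup G) => p.2 a) ∈ layerHoms (sharp (⊤ : Subgroup G)) := by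
  have hr (g : G) {a : G} (ha : a ∈ sharp (⊤ : Subgroup G)) : p.2 (g * a) = p.2 g + p.2 a := by
    rw [hp, quadCochain_sharp_left x _ ha, add_zero]
  have hl (g : G) {a : G} (ha : a ∈ sharp (⊤ : Subgroup G)) : p.2 (a * g) = p.2 a + p.2 g := by
    rw [hp, quadCochain_sharp_right x _ _ ha, add_zero]
  have hhom : (fun a : sharp (⊤ : Subgroup G) => p.2 a) ∈ modTwoHoms (sharp (⊤ : Subgroup G)) :=
    fun a b => hr a b.2
  refine ⟨hhom, fun a ha => ?_⟩
  suffices h : ∀ z ∈ sharp (sharp (⊤ : Subgroup G)), p.2 z = 0 from h a ha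
  intro z hz
  have hmem {z : G} (hz : z ∈ sharp (sharp (⊤ : Subgroup G))) : z ∈ sharp (⊤ : Subgroup G) :=
    sharp_mono_top hz
  unfold sharp at hz
  induction hz using Subgroup.closure_induction with
  | mem z hz =>
    obtain ⟨g, a, ha, b, hb, rfl⟩ := hz
    have hk : g * a * g⁻¹ ∈ sharp (⊤ : Subgroup G) := by
      have := mul_mem (commutator_mem_sharp g (Subgroup.mem_top a)) ha
      simpa using this
    have e : p.2 (g * a * g⁻¹) = p.2 a := by
      have h := hl g hk
      rw [inv_mul_cancel_right, hr g ha, add_comm] at h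
      exact (add_right_cancel h).symm
    have hb2 := modTwoHoms_sq hhom ⟨b, hb⟩
    have ha' := modTwoHoms_inv hhom ⟨a, ha⟩
    simp only [Subgroup.coe_inv] at ha'
    change p.2 (b ^ 2) = 0 at hb2
    rw [hr _ (pow_mem hb 2), hr _ (inv_mem ha), e, hb2, ha', add_zero]
    exact CharTwo.add_self_eq_zero _
  | one => exact modTwoHoms_one (f := fun a : sharp (⊤ : Subgroup G) => p.2 a) hhom
  | mul z w hz hw ihz ihw => rw [hr z (hmem hw), ihz, ihw, add_zero]
  | inv z hz ih =>
    have := modTwoHoms_inv hhom ⟨z, hmem hz⟩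
    simp only [Subgroup.coe_inv] at this
    rw [this, ih]

/-- The squaring map on a group, composed with a homomorphism of the first layer, is a
quadratic cochain on the diagonal. -/
theorem exists_quadCochain_diag (x : Module.Basis ι (ZMod 2) (modTwoHoms G)) {φ : G → ZMod 2}
    (hmul : ∀ a ∈ sharp (⊤ : Subgroup G), ∀ b ∈ sharp (⊤ : Subgroup G), φ (a * b) = φ a + φ b)
    (hconj : ∀ g, ∀ a ∈ sharp (⊤ : Subgroup G), φ (g * a * g⁻¹) = φ a) :
    ∃ u : Sym2 ι → ZMod 2, ∀ g,
      φ (g ^ 2) = quadCochain (fun i => (x i : G → ZMod 2)) u g g := by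
  obtain ⟨e, he⟩ := exists_dual_family x.linearIndependent
  have hsq (g : G) : g ^ 2 ∈ sharp (⊤ : Subgroup G) := sq_mem_sharp trivial
  have hcomm (g h : G) : g⁻¹ * h * g * h⁻¹ ∈ sharp (⊤ : Subgroup G) := by
    simpa using commutator_mem_sharp g⁻¹ (Subgroup.mem_top h)
  -- This commutator pairing is the polar form of `g ↦ φ (g ^ 2)`. It is symmetric because `(g * h)
  -- ^ 2` and `(h * g) ^ 2` are conjugate.
  let b (g h : G) : ZMod 2 := φ (g⁻¹ * h * g * h⁻¹)
  have hq (g h : G) : φ ((g * h) ^ 2) = φ (g ^ 2) + φ (h ^ 2) + b g h := by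
    have e1 : (g * h) ^ 2 = g ^ 2 * (g⁻¹ * h * g * h⁻¹) * h ^ 2 := by
      simp only [pow_two]
      group
    rw [e1, hmul _ (mul_mem (hsq g) (hcomm g h)) _ (hsq h), hmul _ (hsq g) _ (hcomm g h)]
    ring
  have hbsymm (g h : G) : b g h = b h g := by
    have e1 : (g * h) ^ 2 = g * (h * g) ^ 2 * g⁻¹ := by
      simp only [pow_two]
      group
    have h1 := hq g h
    rw [e1, hconj _ _ (hsq _), hq h g] at h1
    linear_combination -h1
  have hbr (g h h' : G) : b g (h * h') = b g h + b g h' := by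
    have e1 : g⁻¹ * (h * h') * g * (h * h')⁻¹ =
        (g⁻¹ * h * g * h⁻¹) * (h * (g⁻¹ * h' * g * h'⁻¹) * h⁻¹) := by group
    have hk : h * (g⁻¹ * h' * g * h'⁻¹) * h⁻¹ ∈ sharp (⊤ : Subgroup G) := by
      have := mul_mem (commutator_mem_sharp h (Subgroup.mem_top (g⁻¹ * h' * g * h'⁻¹)))
        (hcomm g h')
      rwa [inv_mul_cancel_right] at this
    change φ _ = _
    rw [e1, hmul _ (hcomm g h) _ hk, hconj _ _ (hcomm g h')]
  -- The coefficients are read off on the dual family: the quadratic form on the diagonal, its polar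
  -- form elsewhere.
  let u : Sym2 ι → ZMod 2 := Sym2.lift ⟨fun i j => if i = j then φ (e i ^ 2) else b (e i) (e j),
    fun i j => by
      by_cases h : i = j
      · rw [h]
      · simp [h, Ne.symm h, hbsymm]⟩
  let c := quadCochain (fun i => (x i : G → ZMod 2)) u
  -- The difference of the polar forms of `φ (g ^ 2)` and `c g g`. It is additive in each variable
  -- and zero on the dual family, hence zero.
  let β (g h : G) : ZMod 2 := b g h + c g h + c h g
  have hβsymm (g h : G) : β g h = β h g := by
    change b g h + c g h + c h g = b h g + c h g + c g h
    rw [hbsymm]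
    ring
  have hβ (g : G) : β g ∈ modTwoHoms G := fun h h' => by
    change b g (h * h') + c g (h * h') + c (h * h') g =
      b g h + c g h + c h g + (b g h' + c g h' + c h' g)
    have h1 := quadCochain_mul_right (x := x) u g h h'
    have h2 := quadCochain_mul_left (x := x) u h h' g
    rw [hbr]
    linear_combination h1 + h2
  have hβe (i j : ι) : β (e i) (e j) = 0 := by
    by_cases hij : i = j
    · subst hij
      have h1 : b (e i) (e i) = 0 := by
        have : φ 1 = 0 := by simpa using hmul 1 (one_mem _) 1 (one_mem _)
        simp [b, this]
      change b (e i) (e i) + c (e i) (e i) + c (e i) (e i) = 0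
      rw [h1, zero_add]
      exact CharTwo.add_self_eq_zero _
    · have h1 := quadCochain_polar_dual (x := fun i => (x i : G → ZMod 2)) he u hij
      have h2 : u s(i, j) = b (e i) (e j) := by simp [u, hij]
      change b (e i) (e j) + c (e i) (e j) + c (e j) (e i) = 0
      rw [add_assoc, h1, h2]
      exact CharTwo.add_self_eq_zero _
  have hβ1 (i : ι) : β (e i) = 0 := eq_zero_of_dual_family x he (hβ _) (hβe i)
  have hβ0 (g : G) : β g = 0 := eq_zero_of_dual_family x he (hβ g) fun j => by
    rw [hβsymm, hβ1]
    rfl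
  -- Once the polar forms agree, the difference of the quadratic forms is additive and can be tested
  -- on the dual family.
  have hd : (fun g => φ (g ^ 2) + c g g) = 0 := by
    refine eq_zero_of_dual_family x he (fun g h => ?_) fun j => ?_
    · have h0 := congrFun (hβ0 g) h
      change b g h + c g h + c h g = 0 at h0
      change φ ((g * h) ^ 2) + c (g * h) (g * h) = φ (g ^ 2) + c g g + (φ (h ^ 2) + c h h)
      have h1 := quadCochain_mul_left (x := x) u g h (g * h)
      have h2 := quadCochain_mul_right (x := x) u g g h
      have h3 := quadCochain_mul_right (x := x) u h g h
      rw [hq]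
      linear_combination h1 + h2 + h3 + h0
    · have h1 := quadCochain_diag_dual (x := fun i => (x i : G → ZMod 2)) he u j
      have h2 : u s(j, j) = φ (e j ^ 2) := by simp [u]
      change φ (e j ^ 2) + c (e j) (e j) = 0
      rw [← h2]
      change _ + quadCochain _ u _ _ = 0
      rw [h1]
      exact CharTwo.add_self_eq_zero _
  exact ⟨u, fun g => CharTwo.add_eq_zero.mp (congrFun hd g)⟩

/-- The product `G × ℤ/2` with multiplication twisted by a bimultiplicative cochain `c`. -/
structure TwistedProduct (c : G → G → ZMod 2) where
  fst : G
  snd : ZMod 2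

/-- The group structure on `G × ℤ/2` given by `(g, s) (h, t) = (g h, s + t + c(h, g))`. -/
@[reducible] def twistedProductGroup (c : G → G → ZMod 2)
    (hl : ∀ g g' h, c (g * g') h = c g h + c g' h)
    (hr : ∀ g h h', c g (h * h') = c g h + c g h') : Group (TwistedProduct c) :=
  letI : Mul (TwistedProduct c) := ⟨fun p q => ⟨p.1 * q.1, p.2 + q.2 + c q.1 p.1⟩⟩
  letI : One (TwistedProduct c) := ⟨⟨1, 0⟩⟩
  letI : Inv (TwistedProduct c) := ⟨fun p => ⟨p.1⁻¹, -(p.2 + c p.1 p.1⁻¹)⟩⟩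
  Group.ofLeftAxioms
    (fun p q s => by
      change TwistedProduct.mk (p.1 * q.1 * s.1) (p.2 + q.2 + c q.1 p.1 + s.2 + c s.1 (p.1 * q.1)) =
        TwistedProduct.mk (p.1 * (q.1 * s.1)) (p.2 + (q.2 + s.2 + c s.1 q.1) + c (q.1 * s.1) p.1)
      rw [hl, hr, mul_assoc]
      exact congrArg _ (by ring))
    (fun p => by
      have h1 : c p.1 1 = 0 := by simpa using hr p.1 1 1
      change TwistedProduct.mk (1 * p.1) (0 + p.2 + c p.1 1) = p
      rw [h1, one_mul, zero_add, add_zero])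
    (fun p => by
      change TwistedProduct.mk (p.1⁻¹ * p.1) (-(p.2 + c p.1 p.1⁻¹) + p.2 + c p.1 p.1⁻¹) = ⟨1, 0⟩
      rw [inv_mul_cancel, add_assoc, neg_add_cancel])

/-- If the squares of `G` are evaluated by `φ` as by the bimultiplicative cochain `c`, then `c` is
the coboundary of a function extending `φ`. -/
theorem exists_coboundary_extending {G : Type u} [Group G] {φ : G → ZMod 2}
    {c : G → G → ZMod 2} (hl : ∀ g g' h, c (g * g') h = c g h + c g' h)
    (hr : ∀ g h h', c g (h * h') = c g h + c g h')
    (hmul : ∀ a ∈ sharp (⊤ : Subgroup G), ∀ b ∈ sharp (⊤ : Subgroup G), φ (a * b) = φ a + φ b)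
    (hc : ∀ g, φ (g ^ 2) = c g g) :
    ∃ f : G → ZMod 2, (∀ g h, f (g * h) = f g + f h + c h g) ∧
      ∀ a ∈ sharp (⊤ : Subgroup G), f a = φ a := by
  -- In the central extension of `G` by `ℤ/2` with cocycle `c`, the square of `(g, s)` is `(g², c g
  -- g) = (g², φ (g²))`. The squares therefore generate a subgroup missing the central element `(1,
  -- 1)`. A homomorphism `χ` to `ℤ/2` that is nonzero there splits the extension, and `g ↦ χ (g, 0)`
  -- is the primitive.
  let _ := twistedProductGroup c hl hr
  have hmk (g h : G) (s t : ZMod 2) :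
      (⟨g, s⟩ * ⟨h, t⟩ : TwistedProduct c) = ⟨g * h, s + t + c h g⟩ := rfl
  have h1l (g : G) : c 1 g = 0 := by simpa using hl 1 1 g
  have h1r (g : G) : c g 1 = 0 := by simpa using hr g 1 1
  have hφ1 : φ 1 = 0 := by simpa using hmul 1 (one_mem _) 1 (one_mem _)
  -- the subgroup generated by the squares is the graph of `φ`
  have hgraph : ∀ z ∈ sharp (⊤ : Subgroup (TwistedProduct c)),
      z.fst ∈ sharp (⊤ : Subgroup G) ∧ z.snd = φ z.fst := by
    intro z hz
    rw [sharp_top_eq_closure_sq] at hz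
    have hcs (a : G) {b : G} (hb : b ∈ sharp (⊤ : Subgroup G)) : c b a = 0 := by
      have : (fun b => c b a) ∈ modTwoHoms G := fun g g' => hl g g' a
      exact modTwoHoms_sharp_top this hb
    have hmulmem (z w : TwistedProduct c)
        (hz : z.fst ∈ sharp (⊤ : Subgroup G) ∧ z.snd = φ z.fst)
        (hw : w.fst ∈ sharp (⊤ : Subgroup G) ∧ w.snd = φ w.fst) :
        (z * w).fst ∈ sharp (⊤ : Subgroup G) ∧ (z * w).snd = φ (z * w).fst := by
      refine ⟨mul_mem hz.1 hw.1, ?_⟩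
      change z.snd + w.snd + c w.fst z.fst = φ (z.fst * w.fst)
      rw [hmul _ hz.1 _ hw.1, hz.2, hw.2, hcs _ hw.1, add_zero]
    induction hz using Subgroup.closure_induction with
    | mem z hz =>
      obtain ⟨⟨g, s⟩, rfl⟩ := hz
      refine ⟨?_, ?_⟩
      · change ((⟨g, s⟩ : TwistedProduct c) ^ 2).fst ∈ _
        rw [pow_two, hmk, ← pow_two]
        exact sq_mem_sharp trivial
      · change ((⟨g, s⟩ : TwistedProduct c) ^ 2).snd = φ ((⟨g, s⟩ : TwistedProduct c) ^ 2).fst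
        rw [pow_two, hmk]
        change s + s + c g g = φ (g * g)
        rw [CharTwo.add_self_eq_zero, zero_add, ← pow_two, hc]
    | one => exact ⟨one_mem _, hφ1.symm⟩
    | mul z w _ _ hz hw => exact hmulmem z w hz hw
    | inv z _ hz =>
      refine ⟨inv_mem hz.1, ?_⟩
      have hinv : φ z.fst⁻¹ = φ z.fst := by
        have h := hmul _ hz.1 _ (inv_mem hz.1)
        rw [mul_inv_cancel, hφ1] at h
        exact (CharTwo.add_eq_zero.mp h.symm).symm
      change -(z.snd + c z.fst z.fst⁻¹) = φ z.fst⁻¹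
      rw [hcs _ hz.1, add_zero, hinv, hz.2]
      exact CharTwo.neg_eq _
  have hz : (⟨1, 1⟩ : TwistedProduct c) ∉ sharp (⊤ : Subgroup (TwistedProduct c)) := fun h => by
    have := (hgraph _ h).2
    rw [hφ1] at this
    exact one_ne_zero this
  obtain ⟨χ, hχ, hne⟩ := exists_modTwoHom_ne_zero hz
  have hχt (t : ZMod 2) : χ ⟨1, t⟩ = t := by
    fin_cases t
    · exact modTwoHoms_one hχ
    · have h01 (a : ZMod 2) (ha : a ≠ 0) : a = 1 := by
        fin_cases a
        · exact absurd rfl ha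
        · rfl
      exact h01 _ hne
  have hf (g h : G) : χ ⟨g * h, 0⟩ = χ ⟨g, 0⟩ + χ ⟨h, 0⟩ + c h g := by
    have e1 : (⟨g, 0⟩ * ⟨h, 0⟩ : TwistedProduct c) = ⟨g * h, 0⟩ * ⟨1, c h g⟩ := by
      rw [hmk, hmk, h1l]
      simp
    rw [← hχ, e1, hχ, hχt, add_assoc, CharTwo.add_self_eq_zero, add_zero]
  refine ⟨fun g => χ ⟨g, 0⟩, hf, fun a ha => ?_⟩
  have hcs (a : G) {b : G} (hb : b ∈ sharp (⊤ : Subgroup G)) : c b a = 0 := by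
    have : (fun b => c b a) ∈ modTwoHoms G := fun g g' => hl g g' a
    exact modTwoHoms_sharp_top this hb
  -- Both functions are additive on `sharp ⊤`, so comparing them on squares is enough.
  let d : sharp (⊤ : Subgroup G) → ZMod 2 := fun a => χ ⟨a, 0⟩ + φ a
  have hd : d ∈ modTwoHoms (sharp (⊤ : Subgroup G)) := fun a b => by
    change χ ⟨(a : G) * b, 0⟩ + φ ((a : G) * b) = _
    rw [hf, hmul _ a.2 _ b.2, hcs _ b.2]
    change _ = χ ⟨a, 0⟩ + φ a + (χ ⟨b, 0⟩ + φ b)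
    ring
  suffices h : d ⟨a, ha⟩ = 0 from CharTwo.add_eq_zero.mp h
  have hmem {z : G} (hz : z ∈ Subgroup.closure (Set.range fun g : G => g ^ 2)) :
      z ∈ sharp (⊤ : Subgroup G) := by rwa [sharp_top_eq_closure_sq]
  have ha' := ha
  rw [sharp_top_eq_closure_sq] at ha'
  induction ha' using Subgroup.closure_induction with
  | mem z hz =>
    obtain ⟨g, rfl⟩ := hz
    change χ ⟨g ^ 2, 0⟩ + φ (g ^ 2) = 0
    rw [hc, pow_two, hf, CharTwo.add_self_eq_zero, zero_add]
    exact CharTwo.add_self_eq_zero _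
  | one => exact modTwoHoms_one hd
  | mul z w hz hw ihz ihw =>
    exact (hd ⟨z, hmem hz⟩ ⟨w, hmem hw⟩).trans (by rw [ihz, ihw, add_zero])
  | inv z hz ih => exact (modTwoHoms_inv hd ⟨z, hmem hz⟩).trans (ih _)

/-- Every homomorphism of the first layer is the restriction of a function on `G` whose
coboundary is a quadratic cochain. -/
theorem exists_twistedHoms_restrict {G : Type u} [Group G]
    (x : Module.Basis ι (ZMod 2) (modTwoHoms G))
    {φ : sharp (⊤ : Subgroup G) → ZMod 2} (hφ : φ ∈ layerHoms (sharp (⊤ : Subgroup G))) :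
    ∃ p ∈ twistedHoms x, (fun a : sharp (⊤ : Subgroup G) => p.2 a) = φ := by
  classical
  -- Extension by zero only provides a function on all of `G`; the values outside `sharp ⊤` play no
  -- role.
  let ψ : G → ZMod 2 := fun g => if h : g ∈ sharp (⊤ : Subgroup G) then φ ⟨g, h⟩ else 0
  have hψ {g : G} (h : g ∈ sharp (⊤ : Subgroup G)) : ψ g = φ ⟨g, h⟩ := dif_pos h
  have hmul : ∀ a ∈ sharp (⊤ : Subgroup G), ∀ b ∈ sharp (⊤ : Subgroup G),
      ψ (a * b) = ψ a + ψ b := fun a ha b hb => by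
    rw [hψ ha, hψ hb, hψ (mul_mem ha hb)]
    exact hφ.1 ⟨a, ha⟩ ⟨b, hb⟩
  have hconj : ∀ g, ∀ a ∈ sharp (⊤ : Subgroup G), ψ (g * a * g⁻¹) = ψ a := fun g a ha => by
    have h1 : g * a * g⁻¹ * a⁻¹ ∈ sharp (⊤ : Subgroup G) :=
      commutator_mem_sharp g (Subgroup.mem_top a)
    have h2 : ψ (g * a * g⁻¹ * a⁻¹) = 0 := by
      rw [hψ h1]
      exact hφ.2 _ (commutator_mem_sharp g ha)
    have h3 := hmul _ h1 _ ha
    rwa [h2, zero_add, inv_mul_cancel_right] at h3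
  obtain ⟨u, hu⟩ := exists_quadCochain_diag x hmul hconj
  obtain ⟨f, hf, hfψ⟩ := exists_coboundary_extending
    (fun g g' h => quadCochain_mul_left (x := x) u g g' h)
    (fun g h h' => quadCochain_mul_right (x := x) u g h h') hmul hu
  exact ⟨(u, f), hf, funext fun a => (hfψ a a.2).trans (hψ a.2)⟩

/-- The restriction of functions on `G` to the first term of the series. -/
noncomputable def twistedRestrict (x : ι → modTwoHoms G) :
    twistedHoms x →ₗ[ZMod 2] layerHoms (sharp (⊤ : Subgroup G)) where
  toFun p := ⟨fun a => p.1.2 a, twistedHoms_restrict_mem p.2⟩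
  map_add' _ _ := rfl
  map_smul' _ _ := rfl

/-- Vanishing on squares kills the diagonal of the quadratic cochain and so its coefficients;
conversely, homomorphisms to `ℤ/2` vanish on `sharp ⊤`. With equal kernels, the two maps have ranges
of the same dimension. -/
theorem ker_twistedRestrict {x : ι → modTwoHoms G} (hx : LinearIndependent (ZMod 2) x) :
    LinearMap.ker (twistedRestrict x) = LinearMap.ker (twistedFst x) := by
  ext p
  constructor
  · intro h
    have h0 (a : sharp (⊤ : Subgroup G)) : p.1.2 a = 0 := congrFun (congrArg Subtype.val h) a
    refine eq_zero_of_quadCochain_diag hx fun g => ?_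
    refine (twistedHoms_sq p.2 g).symm.trans ?_
    exact h0 ⟨g ^ 2, sq_mem_sharp trivial⟩
  · intro h
    refine Subtype.ext (funext fun a => ?_)
    exact modTwoHoms_sharp_top (kerTwistedFstEquiv x ⟨p, h⟩).2 a.2

/-- The dimension of the first layer of the mod-2 lower central series. -/
theorem finite_and_finrank_layer {G : Type u} [Group G]
    [Module.Finite (ZMod 2) (modTwoHoms G)]
    (x : Module.Basis ι (ZMod 2) (modTwoHoms G)) :
    Module.Finite (ZMod 2) (ModTwoLayer G 1) ∧
      Module.finrank (ZMod 2) (ModTwoLayer G 1) = Module.finrank (ZMod 2) (boundingCoeffs x) := by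
  have hfin := finite_twistedHoms x
  have hsurj : Function.Surjective (twistedRestrict x) := fun φ => by
    obtain ⟨p, hp, h⟩ := exists_twistedHoms_restrict x φ.2
    exact ⟨⟨p, hp⟩, Subtype.ext h⟩
  have hfin' : Module.Finite (ZMod 2) (layerHoms (sharp (⊤ : Subgroup G))) :=
    Module.Finite.of_surjective _ hsurj
  have hrank : Module.finrank (ZMod 2) (layerHoms (sharp (⊤ : Subgroup G))) =
      Module.finrank (ZMod 2) (boundingCoeffs x) := by
    have h1 := (twistedRestrict x).finrank_range_add_finrank_ker
    have h2 := (twistedFst x).finrank_range_add_finrank_ker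
    rw [ker_twistedRestrict x.linearIndependent, LinearMap.range_eq_top.mpr hsurj,
      finrank_top] at h1
    rw [range_twistedFst] at h2
    omega
  have hdual := dualLayerEquiv (sharp (⊤ : Subgroup G))
  have hfd : Module.Finite (ZMod 2) (Module.Dual (ZMod 2) (ModTwoLayer G 1)) :=
    Module.Finite.equiv hdual.symm
  have hf : Module.Finite (ZMod 2) (ModTwoLayer G 1) :=
    (Module.finite_dual_iff (ZMod 2)).mp hfd
  exact ⟨hf, by rw [← hrank, ← hdual.finrank_eq]; exact (Subspace.dual_finrank_eq).symm⟩

end Twisted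

end Layers

/-! ### Kernels of homomorphisms onto elementary abelian groups -/

section Kernel

variable {G : Type u} [Group G] {m : ℕ}

/-- The coordinates of a homomorphism to `(ℤ/2)^m`. -/
def coordHom (π : G →* Multiplicative (Fin m → ZMod 2)) (i : Fin m) : modTwoHoms G :=
  ⟨fun g => (π g).toAdd i, fun g h => by simp⟩

theorem linearIndependent_coordHom {π : G →* Multiplicative (Fin m → ZMod 2)}
    (hπ : Function.Surjective π) : LinearIndependent (ZMod 2) (coordHom π) := by
  rw [Fintype.linearIndependent_iff]
  intro c hc i
  obtain ⟨g, hg⟩ := hπ (Multiplicative.ofAdd (Pi.single i 1))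
  have h := congrFun (congrArg Subtype.val hc) g
  simpa [coordHom, hg, Pi.single_apply] using h

/-- Such an `f` factors through `(ℤ/2)^m`, where every functional is a combination of coordinates.
-/
theorem mem_span_coordHom {π : G →* Multiplicative (Fin m → ZMod 2)}
    (hπ : Function.Surjective π) {f : modTwoHoms G} (hf : ∀ g ∈ π.ker, f.1 g = 0) :
    f ∈ Submodule.span (ZMod 2) (Set.range (coordHom π)) := by
  have hπf {g h : G} (e : π g = π h) : f.1 g = f.1 h := by
    have h1 := hf (g * h⁻¹) (by rw [MonoidHom.mem_ker, map_mul, map_inv, e, mul_inv_cancel])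
    rw [f.2, modTwoHoms_inv f.2] at h1
    exact CharTwo.add_eq_zero.mp h1
  choose s hs using fun v => hπ (Multiplicative.ofAdd v)
  let f' : (Fin m → ZMod 2) →ₗ[ZMod 2] ZMod 2 := AddMonoidHom.toZModLinearMap 2
    (AddMonoidHom.mk' (fun v => f.1 (s v)) fun v w => by
      rw [← f.2]
      exact hπf (by rw [map_mul, hs, hs, hs, ofAdd_add]))
  have h : f = ∑ i, f' (Pi.single i 1) • coordHom π i := by
    refine Subtype.ext (funext fun g => ?_)
    have h1 : f.1 g = f' (π g).toAdd := hπf (by rw [hs]; rfl)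
    rw [h1]
    conv_lhs => rw [← Finset.univ_sum_single (π g).toAdd, map_sum]
    simp only [AddSubmonoidClass.coe_finsetSum, Submodule.coe_smul, Finset.sum_apply,
      Pi.smul_apply]
    refine Finset.sum_congr rfl fun i _ => ?_
    have h2 : (Pi.single i ((π g).toAdd i) : Fin m → ZMod 2) =
        (π g).toAdd i • Pi.single i 1 := by
      rw [← Pi.single_smul', smul_eq_mul, mul_one]
    rw [h2, map_smul, smul_eq_mul, smul_eq_mul, mul_comm]
    rfl
  rw [h]
  exact Submodule.sum_mem _ fun i _ =>
    Submodule.smul_mem _ _ (Submodule.subset_span ⟨i, rfl⟩)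

/-- A linearly independent family in a finite-dimensional space extends to a basis. -/
theorem exists_basis_extending {K V : Type*} [Field K] [AddCommGroup V] [Module K V]
    [Module.Finite K V] {m : ℕ} {v : Fin m → V} (hv : LinearIndependent K v) :
    ∃ (k : ℕ) (x : Module.Basis (Fin m ⊕ Fin k) K V), ∀ i, x (Sum.inl i) = v i := by
  classical
  let y := Module.Basis.sumExtend hv
  have hy (i : Fin m) : y (Sum.inl i) = v i := by
    simp only [y, Module.Basis.sumExtend, Module.Basis.reindex_apply]
    exact Module.Basis.extend_apply_self _ _
  have : Fintype (Fin m ⊕ Module.Basis.sumExtendIndex hv) :=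
    Module.Basis.fintypeIndexOfRankLtAleph0 y (Module.rank_lt_aleph0 K V)
  have : Fintype (Module.Basis.sumExtendIndex hv) :=
    Fintype.ofInjective (Sum.inr : _ → Fin m ⊕ Module.Basis.sumExtendIndex hv) Sum.inr_injective
  refine ⟨_, y.reindex (Equiv.sumCongr (Equiv.refl _)
    (Fintype.equivFin (Module.Basis.sumExtendIndex hv))), fun i => ?_⟩
  rw [Module.Basis.reindex_apply]
  exact hy i

/-! ### Restriction of primitives to the kernel -/

section Restrict

variable {k : ℕ} (x : Fin m ⊕ Fin k → modTwoHoms G)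

/-- The coefficients on the pairs of homomorphisms of the second block. -/
noncomputable def blockCoeffs : twistedHoms x →ₗ[ZMod 2] (Sym2 (Fin k) → ZMod 2) :=
  (LinearMap.funLeft (ZMod 2) (ZMod 2) (Sym2.map (Sum.inr : Fin k → Fin m ⊕ Fin k))) ∘ₗ
    twistedFst x

variable {x} {N : Subgroup G}

/-- Pairs within the second block have coefficient zero, and any other pair contains a homomorphism
vanishing on `N`. -/
theorem quadCochain_ker_blockCoeffs (hx : ∀ i, ∀ g ∈ N, (x (Sum.inl i)).1 g = 0)
    (p : LinearMap.ker (blockCoeffs x)) {g h : G} (hg : g ∈ N) (hh : h ∈ N) :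
    quadCochain (fun i => (x i : G → ZMod 2)) p.1.1.1 g h = 0 := by
  refine Finset.sum_eq_zero fun s _ => ?_
  have hs := sym2_mk_out s
  generalize (Quot.out s).1 = a at *
  generalize (Quot.out s).2 = b at *
  subst hs
  match a, b with
  | Sum.inl i, b => simp [hx i g hg]
  | a, Sum.inl i => simp [hx i h hh]
  | Sum.inr i, Sum.inr j =>
    have h0 : p.1.1.1 s(Sum.inr i, Sum.inr j) = 0 := congrFun p.2 s(i, j)
    rw [h0, zero_mul]

/-- The restriction to a subgroup on which the first block of homomorphisms vanishes. -/
noncomputable def blockRestrict (hx : ∀ i, ∀ g ∈ N, (x (Sum.inl i)).1 g = 0) :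
    LinearMap.ker (blockCoeffs x) →ₗ[ZMod 2] modTwoHoms N where
  toFun p := ⟨fun g => p.1.1.2 g, fun g h => by
    have := p.1.2 (g : G) h
    rwa [quadCochain_ker_blockCoeffs hx p h.2 g.2, add_zero] at this⟩
  map_add' _ _ := rfl
  map_smul' _ _ := rfl

/-- A primitive vanishing on `N` vanishes on all squares of `G`, and these determine the
coefficients. -/
theorem fst_eq_zero_of_mem_ker_blockRestrict (hli : LinearIndependent (ZMod 2) x)
    (hN : ∀ g : G, g ^ 2 ∈ N) (hx : ∀ i, ∀ g ∈ N, (x (Sum.inl i)).1 g = 0)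
    (p : LinearMap.ker (blockRestrict hx)) : p.1.1.1.1 = 0 := by
  refine eq_zero_of_quadCochain_diag hli fun g => ?_
  refine (twistedHoms_sq p.1.1.2 g).symm.trans ?_
  exact congrFun (congrArg Subtype.val p.2) ⟨g ^ 2, hN g⟩

/-- The kernel of the restriction, as a space of homomorphisms. -/
noncomputable def kerBlockRestrict (hli : LinearIndependent (ZMod 2) x)
    (hN : ∀ g : G, g ^ 2 ∈ N) (hx : ∀ i, ∀ g ∈ N, (x (Sum.inl i)).1 g = 0) :
    LinearMap.ker (blockRestrict hx) →ₗ[ZMod 2] modTwoHoms G where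
  toFun p := ⟨p.1.1.1.2, by
    rw [← zero_prod_mem_twistedHoms (x := x),
      ← fst_eq_zero_of_mem_ker_blockRestrict hli hN hx p]
    exact p.1.1.2⟩
  map_add' _ _ := rfl
  map_smul' _ _ := rfl

theorem kerBlockRestrict_injective (hli : LinearIndependent (ZMod 2) x)
    (hN : ∀ g : G, g ^ 2 ∈ N) (hx : ∀ i, ∀ g ∈ N, (x (Sum.inl i)).1 g = 0) :
    Function.Injective (kerBlockRestrict hli hN hx) := fun p q h => by
  refine Subtype.ext (Subtype.ext (Subtype.ext (Prod.ext ?_ (congrArg Subtype.val h))))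
  rw [fst_eq_zero_of_mem_ker_blockRestrict hli hN hx p,
    fst_eq_zero_of_mem_ker_blockRestrict hli hN hx q]

theorem kerBlockRestrict_apply (hli : LinearIndependent (ZMod 2) x)
    (hN : ∀ g : G, g ^ 2 ∈ N) (hx : ∀ i, ∀ g ∈ N, (x (Sum.inl i)).1 g = 0)
    (p : LinearMap.ker (blockRestrict hx)) {g : G} (hg : g ∈ N) :
    (kerBlockRestrict hli hN hx p).1 g = 0 :=
  congrFun (congrArg Subtype.val p.2) ⟨g, hg⟩

end Restrict

/-- A lower bound for the number of homomorphisms to `ℤ/2` of the kernel of a homomorphism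
onto `(ℤ/2)^m`. -/
theorem finrank_modTwoHoms_ker {π : G →* Multiplicative (Fin m → ZMod 2)}
    (hπ : Function.Surjective π) [Module.Finite (ZMod 2) (modTwoHoms G)]
    [Module.Finite (ZMod 2) (modTwoHoms π.ker)] :
    ∃ k : ℕ, Module.finrank (ZMod 2) (modTwoHoms G) = m + k ∧
      Module.finrank (ZMod 2) (ModTwoLayer G 1) + (m + k) ≤
        Module.finrank (ZMod 2) (modTwoHoms π.ker) + (k + 1).choose 2 + m := by
  obtain ⟨k, x, hxl⟩ := exists_basis_extending (linearIndependent_coordHom hπ)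
  have hr : Module.finrank (ZMod 2) (modTwoHoms G) = m + k := by
    simp [Module.finrank_eq_card_basis x]
  refine ⟨k, hr, ?_⟩
  have hfin := finite_twistedHoms x
  -- The left side is now the dimension of `twistedHoms x`, which is the sum of the rank of
  -- `blockCoeffs`, the rank of `blockRestrict` and the dimension of the kernel of the latter.
  rw [(finite_and_finrank_layer x).2, ← hr, ← finrank_twistedHoms x]
  have hx (i : Fin m) (g : G) (hg : g ∈ π.ker) : (x (Sum.inl i)).1 g = 0 := by
    rw [hxl]
    change (π g).toAdd i = 0
    rw [MonoidHom.mem_ker.mp hg]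
    rfl
  have hN (g : G) : g ^ 2 ∈ π.ker := by
    rw [MonoidHom.mem_ker, map_pow]
    refine Multiplicative.toAdd.injective (funext fun i => ?_)
    rw [toAdd_pow, two_nsmul]
    exact CharTwo.add_self_eq_zero _
  have h1 := (blockCoeffs x).finrank_range_add_finrank_ker
  have h2 := (blockRestrict hx).finrank_range_add_finrank_ker
  have h3 : Module.finrank (ZMod 2) (LinearMap.range (blockCoeffs x)) ≤ (k + 1).choose 2 := by
    refine (Submodule.finrank_le _).trans ?_
    rw [Module.finrank_fintype_fun_eq_card, Sym2.card, Fintype.card_fin]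
  have h4 : Module.finrank (ZMod 2) (LinearMap.range (blockRestrict hx)) ≤
      Module.finrank (ZMod 2) (modTwoHoms π.ker) := Submodule.finrank_le _
  have h5 : Module.finrank (ZMod 2) (LinearMap.ker (blockRestrict hx)) ≤ m := by
    have hle : LinearMap.range (kerBlockRestrict x.linearIndependent hN hx) ≤
        Submodule.span (ZMod 2) (Set.range (coordHom π)) := by
      rintro _ ⟨p, rfl⟩
      exact mem_span_coordHom hπ fun g hg => kerBlockRestrict_apply _ hN hx p hg
    rw [← LinearMap.finrank_range_of_inj (kerBlockRestrict_injective x.linearIndependent hN hx)]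
    refine (Submodule.finrank_mono hle).trans ?_
    simpa [Set.finrank] using finrank_range_le_card (R := ZMod 2) (coordHom π)
  omega

end Kernel

/-! ### Finiteness -/

/-- A homomorphism is determined by its values on a finite generating set. -/
theorem finite_modTwoHoms_of_fg (G : Type*) [Group G] [hG : Group.FG G] :
    Module.Finite (ZMod 2) (modTwoHoms G) := by
  obtain ⟨S, hS⟩ := Group.fg_iff'.mp hG
  obtain ⟨S, -, hS⟩ := hS
  let ρ : modTwoHoms G →ₗ[ZMod 2] (S → ZMod 2) :=
    { toFun := fun f s => f.1 s
      map_add' := fun _ _ => rfl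
      map_smul' := fun _ _ => rfl }
  refine Module.Finite.of_injective ρ ?_
  rw [← LinearMap.ker_eq_bot, LinearMap.ker_eq_bot']
  intro f hf
  refine Subtype.ext (funext fun g => ?_)
  have hg : g ∈ Subgroup.closure (S : Set G) := hS ▸ Subgroup.mem_top g
  induction hg using Subgroup.closure_induction with
  | mem x hx => exact congrFun hf ⟨x, hx⟩
  | one => exact modTwoHoms_one f.2
  | mul x y _ _ hx hy => exact (f.2 x y).trans (by rw [hx, hy]; rfl)
  | inv x _ hx => exact (modTwoHoms_inv f.2 x).trans hx

/-- Isomorphic groups have isomorphic spaces of homomorphisms to `ℤ/2`. -/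
def modTwoHomsCongr {G H : Type*} [Group G] [Group H] (e : G ≃* H) :
    modTwoHoms H ≃ₗ[ZMod 2] modTwoHoms G where
  toFun f := ⟨fun g => f.1 (e g), fun g h => by simp only [map_mul, f.2 (e g) (e h)]⟩
  map_add' _ _ := rfl
  map_smul' _ _ := rfl
  invFun f := ⟨fun g => f.1 (e.symm g), fun g h => by
    simp only [map_mul, f.2 (e.symm g) (e.symm h)]⟩
  left_inv f := by ext; simp
  right_inv f := by ext; simp

/-! ### Singular simplices of dimension one and two -/

section Simplices

variable {X : Type u} [TopologicalSpace X]

/-- The value of a singular simplex at a point of the standard simplex. -/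
noncomputable def simplexEval {n : ℕ} (σ : SingularSimplex X n) :
    C(stdSimplex ℝ (Fin (n + 1)), X) :=
  TopCat.toSSetObjEquiv (TopCat.of X) (Opposite.op ⦋n⦌) σ

/-- The singular simplex given by a continuous map. -/
noncomputable def simplexMk {n : ℕ} (f : C(stdSimplex ℝ (Fin (n + 1)), X)) :
    SingularSimplex X n :=
  (TopCat.toSSetObjEquiv (TopCat.of X) (Opposite.op ⦋n⦌)).symm f

theorem simplexEval_mk {n : ℕ} (f : C(stdSimplex ℝ (Fin (n + 1)), X)) :
    simplexEval (simplexMk f) = f :=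
  (TopCat.toSSetObjEquiv (TopCat.of X) (Opposite.op ⦋n⦌)).apply_symm_apply f

theorem simplexEval_injective {n : ℕ} :
    Function.Injective (simplexEval : SingularSimplex X n → _) :=
  (TopCat.toSSetObjEquiv (TopCat.of X) (Opposite.op ⦋n⦌)).injective

theorem simplexEval_face {n : ℕ} (σ : SingularSimplex X (n + 1)) (i : Fin (n + 2))
    (t : stdSimplex ℝ (Fin (n + 1))) :
    simplexEval ((TopCat.toSSet.obj (TopCat.of X)).δ i σ) t =
      simplexEval σ (stdSimplex.map i.succAbove t) :=
  rfl

/-- The point of the standard `1`-simplex with second coordinate `s`. -/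
def edgePoint (s : unitInterval) : stdSimplex ℝ (Fin 2) :=
  ⟨![1 - s, s], by
    intro i
    fin_cases i
    · exact sub_nonneg.mpr s.2.2
    · exact s.2.1, by simp⟩

theorem continuous_edgePoint : Continuous edgePoint := by
  refine Continuous.subtype_mk (continuous_pi fun i => ?_) _
  fin_cases i
  · exact continuous_const.sub continuous_subtype_val
  · exact continuous_subtype_val

/-- The second coordinate of a point of the standard `1`-simplex. -/
def edgeCoord (t : stdSimplex ℝ (Fin 2)) : unitInterval := ⟨t.1 1, t.2.1 1, by
  have h1 := t.2.2
  have h0 := t.2.1 0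
  rw [Fin.sum_univ_two] at h1
  linarith⟩

theorem continuous_edgeCoord : Continuous edgeCoord :=
  Continuous.subtype_mk ((continuous_apply 1).comp continuous_subtype_val) _

theorem edgePoint_edgeCoord (t : stdSimplex ℝ (Fin 2)) : edgePoint (edgeCoord t) = t := by
  refine Subtype.ext (funext fun i => ?_)
  have h1 := t.2.2
  rw [Fin.sum_univ_two] at h1
  fin_cases i
  · change 1 - t.1 1 = t.1 0
    linarith
  · rfl

/-- The path traversed by a singular `1`-simplex. -/
noncomputable def simplexPath (σ : SingularSimplex X 1) :
    Path (simplexEval σ (edgePoint 0)) (simplexEval σ (edgePoint 1)) where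
  toFun s := simplexEval σ (edgePoint s)
  continuous_toFun := (simplexEval σ).continuous.comp continuous_edgePoint
  source' := rfl
  target' := rfl

/-- The singular `1`-simplex given by a path. -/
noncomputable def simplexOfPath {x y : X} (p : Path x y) : SingularSimplex X 1 :=
  simplexMk ⟨fun t => p (edgeCoord t), p.continuous.comp continuous_edgeCoord⟩

theorem simplexEval_ofPath {x y : X} (p : Path x y) (s : unitInterval) :
    simplexEval (simplexOfPath p) (edgePoint s) = p s := by
  rw [simplexOfPath, simplexEval_mk]
  rfl

theorem eq_simplexOfPath {x y : X} {p : Path x y} {σ : SingularSimplex X 1}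
    (h : ∀ s, simplexEval σ (edgePoint s) = p s) : σ = simplexOfPath p := by
  refine simplexEval_injective (ContinuousMap.ext fun t => ?_)
  rw [← edgePoint_edgeCoord t, h, simplexEval_ofPath]

theorem simplexOfPath_simplexPath (σ : SingularSimplex X 1) :
    simplexOfPath (simplexPath σ) = σ :=
  (eq_simplexOfPath fun _ => rfl).symm

instance : ContractibleSpace (stdSimplex ℝ (Fin 3)) :=
  (convex_stdSimplex ℝ (Fin 3)).contractibleSpace ⟨_, single_mem_stdSimplex ℝ 0⟩

/-- The edge of the standard `2`-simplex opposite to a vertex. -/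
noncomputable def trianglePath (i : Fin 3) :
    Path (stdSimplex.map i.succAbove (edgePoint 0)) (stdSimplex.map i.succAbove (edgePoint 1)) where
  toFun s := stdSimplex.map i.succAbove (edgePoint s)
  continuous_toFun := (stdSimplex.continuous_map _).comp continuous_edgePoint
  source' := rfl
  target' := rfl

theorem edgePoint_zero : edgePoint 0 = stdSimplex.vertex (S := ℝ) (0 : Fin 2) := by
  refine Subtype.ext (funext fun i => ?_)
  fin_cases i <;> simp [edgePoint]

theorem edgePoint_one : edgePoint 1 = stdSimplex.vertex (S := ℝ) (1 : Fin 2) := by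
  refine Subtype.ext (funext fun i => ?_)
  fin_cases i <;> simp [edgePoint]

/-- The edges of a singular `2`-simplex, as composable paths. -/
theorem exists_paths_of_triangle (σ : SingularSimplex X 2) :
    ∃ (x y z : X) (p : Path x y) (q : Path y z) (r : Path x z),
      (p.trans q).Homotopic r ∧
      (TopCat.toSSet.obj (TopCat.of X)).δ 2 σ = simplexOfPath p ∧
      (TopCat.toSSet.obj (TopCat.of X)).δ 0 σ = simplexOfPath q ∧
      (TopCat.toSSet.obj (TopCat.of X)).δ 1 σ = simplexOfPath r := by
  have v (i : Fin 3) (j : Fin 2) : stdSimplex.map i.succAbove (stdSimplex.vertex (S := ℝ) j) =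
      stdSimplex.vertex (i.succAbove j) := stdSimplex.map_vertex _ _
  let P : Path (stdSimplex.vertex (S := ℝ) (0 : Fin 3)) (stdSimplex.vertex 1) :=
    (trianglePath 2).cast (by rw [edgePoint_zero, v]; rfl) (by rw [edgePoint_one, v]; rfl)
  let Q : Path (stdSimplex.vertex (S := ℝ) (1 : Fin 3)) (stdSimplex.vertex 2) :=
    (trianglePath 0).cast (by rw [edgePoint_zero, v]; rfl) (by rw [edgePoint_one, v]; rfl)
  let R : Path (stdSimplex.vertex (S := ℝ) (0 : Fin 3)) (stdSimplex.vertex 2) :=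
    (trianglePath 1).cast (by rw [edgePoint_zero, v]; rfl) (by rw [edgePoint_one, v]; rfl)
  -- The triangle is simply connected, so its two edge routes are homotopic; the simplex carries the
  -- homotopy to `X`.
  have h : (P.trans Q).Homotopic R := SimplyConnectedSpace.paths_homotopic _ _
  refine ⟨_, _, _, P.map (simplexEval σ).continuous, Q.map (simplexEval σ).continuous,
    R.map (simplexEval σ).continuous, ?_, ?_, ?_, ?_⟩
  · rw [← Path.map_trans]
    exact h.map (simplexEval σ)
  all_goals exact eq_simplexOfPath fun _ => rfl

/-- The map from the square to the standard `2`-simplex that collapses the two vertical sides. -/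
noncomputable def squareToTriangle (w : unitInterval × unitInterval) : stdSimplex ℝ (Fin 3) :=
  -- For a fixed second coordinate, the point moves linearly from the broken edge `0 → 1 → 2` (first
  -- coordinate `0`) to the straight edge `0 → 2` (first coordinate `1`).
  ⟨![1 - w.2 - (1 - w.1) * min (w.2 : ℝ) (1 - w.2), 2 * ((1 - w.1) * min (w.2 : ℝ) (1 - w.2)),
    w.2 - (1 - w.1) * min (w.2 : ℝ) (1 - w.2)], by
    have h1 : (0 : ℝ) ≤ min (w.2 : ℝ) (1 - w.2) := le_min w.2.2.1 (sub_nonneg.mpr w.2.2.2)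
    have h2 : (1 - w.1 : ℝ) * min (w.2 : ℝ) (1 - w.2) ≤ min (w.2 : ℝ) (1 - w.2) :=
      mul_le_of_le_one_left h1 (by linarith [w.1.2.1])
    have h3 : (0 : ℝ) ≤ (1 - w.1 : ℝ) * min (w.2 : ℝ) (1 - w.2) :=
      mul_nonneg (sub_nonneg.mpr w.1.2.2) h1
    intro i
    fin_cases i
    · exact sub_nonneg.mpr (h2.trans (min_le_right _ _))
    · exact mul_nonneg zero_le_two h3
    · exact sub_nonneg.mpr (h2.trans (min_le_left _ _)), by
    simp only [Fin.sum_univ_three, Matrix.cons_val_zero, Matrix.cons_val_one, Matrix.cons_val]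
    ring⟩

theorem continuous_squareToTriangle : Continuous squareToTriangle := by
  refine Continuous.subtype_mk (continuous_pi fun i => ?_) _
  fin_cases i
  · change Continuous fun w : unitInterval × unitInterval =>
      (1 - w.2 - (1 - w.1) * min (w.2 : ℝ) (1 - w.2) : ℝ)
    fun_prop
  · change Continuous fun w : unitInterval × unitInterval =>
      (2 * ((1 - w.1) * min (w.2 : ℝ) (1 - w.2)) : ℝ)
    fun_prop
  · change Continuous fun w : unitInterval × unitInterval =>
      (w.2 - (1 - w.1) * min (w.2 : ℝ) (1 - w.2) : ℝ)
    fun_prop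

theorem squareToTriangle_surjective : Function.Surjective squareToTriangle := by
  intro t
  have hs := t.2.2
  have h0 := t.2.1 0
  have h1 := t.2.1 1
  have h2 := t.2.1 2
  rw [Fin.sum_univ_three] at hs
  set a := t.1 0 with ha
  set b := t.1 1 with hb
  set c := t.1 2 with hc
  have hm : b / 2 ≤ min (c + b / 2) (1 - (c + b / 2)) := le_min (by linarith) (by linarith)
  -- The preimage has second coordinate `c + b / 2`, and its first coordinate solves `(1 - w.1) * m
  -- = b / 2`. When `m = 0`, also `b = 0`, so the convention for division by zero is harmless.
  set m := min (c + b / 2) (1 - (c + b / 2)) with hmdef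
  have hm0 : 0 ≤ m := le_trans (by linarith) hm
  have hu : b / 2 / m ≤ 1 := div_le_one_of_le₀ hm hm0
  have hu0 : 0 ≤ b / 2 / m := div_nonneg (by linarith) hm0
  have hmul : b / 2 / m * m = b / 2 := by
    rcases hm0.eq_or_lt with h | h
    · have : b / 2 = 0 := le_antisymm (hm.trans_eq h.symm) (by linarith)
      rw [this, zero_div, zero_mul]
    · exact div_mul_cancel₀ _ h.ne'
  refine ⟨(⟨1 - b / 2 / m, by linarith, by linarith⟩,
    ⟨c + b / 2, by linarith, by linarith⟩), ?_⟩
  have key : (1 - (1 - b / 2 / m)) * min (c + b / 2) (1 - (c + b / 2)) = b / 2 := by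
    rw [← hmdef, sub_sub_cancel, hmul]
  refine Subtype.ext (funext fun i => ?_)
  fin_cases i
  · change 1 - (c + b / 2) - (1 - (1 - b / 2 / m)) * min (c + b / 2) (1 - (c + b / 2)) = a
    rw [key]
    linarith
  · change 2 * ((1 - (1 - b / 2 / m)) * min (c + b / 2) (1 - (c + b / 2))) = b
    rw [key]
    linarith
  · change c + b / 2 - (1 - (1 - b / 2 / m)) * min (c + b / 2) (1 - (c + b / 2)) = c
    rw [key]
    linarith

/-- The fibres of `squareToTriangle` are points, except for the two vertical sides. -/
theorem squareToTriangle_eq {w w' : unitInterval × unitInterval}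
    (h : squareToTriangle w = squareToTriangle w') :
    w.2 = w'.2 ∧ (w.1 = w'.1 ∨ w.2 = 0 ∨ w.2 = 1) := by
  have e1 : (2 * ((1 - w.1) * min (w.2 : ℝ) (1 - w.2)) : ℝ) =
      2 * ((1 - w'.1) * min (w'.2 : ℝ) (1 - w'.2)) := congrArg (fun t => t.1 1) h
  have e2 : (w.2 - (1 - w.1) * min (w.2 : ℝ) (1 - w.2) : ℝ) =
      w'.2 - (1 - w'.1) * min (w'.2 : ℝ) (1 - w'.2) := congrArg (fun t => t.1 2) h
  have e3 : (w.2 : ℝ) = w'.2 := by linarith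
  refine ⟨Subtype.ext e3, ?_⟩
  by_cases hm : min (w.2 : ℝ) (1 - w.2) = 0
  · right
    rcases min_choice (w.2 : ℝ) (1 - w.2) with h' | h'
    · exact Or.inl (Subtype.ext (h'.symm.trans hm))
    · refine Or.inr (Subtype.ext ?_)
      change (w.2 : ℝ) = 1
      linarith
  · left
    rw [← e3] at e1
    have := mul_right_cancel₀ hm (mul_left_cancel₀ two_ne_zero e1)
    exact Subtype.ext (by linarith)

theorem stdSimplex_map_apply {m n : ℕ} (f : Fin m → Fin n) (t : stdSimplex ℝ (Fin m)) (i : Fin n) :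
    (stdSimplex.map f t).1 i = ∑ j, if f j = i then t.1 j else 0 := by
  change FunOnFinite.linearMap ℝ ℝ f t i = _
  rw [FunOnFinite.linearMap_apply_apply, Finset.sum_filter]
  rfl

theorem map_edgePoint_two (s : unitInterval) :
    (stdSimplex.map (Fin.succAbove 2) (edgePoint s)).1 = ![1 - (s : ℝ), s, 0] := by
  funext i
  rw [stdSimplex_map_apply, Fin.sum_univ_two]
  fin_cases i <;> simp [edgePoint, Fin.succAbove, Fin.ext_iff]

theorem map_edgePoint_zero (s : unitInterval) :
    (stdSimplex.map (Fin.succAbove 0) (edgePoint s)).1 = ![0, 1 - (s : ℝ), s] := by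
  funext i
  rw [stdSimplex_map_apply, Fin.sum_univ_two]
  fin_cases i <;> simp [edgePoint, Fin.succAbove, Fin.ext_iff]

theorem map_edgePoint_one (s : unitInterval) :
    (stdSimplex.map (Fin.succAbove 1) (edgePoint s)).1 = ![1 - (s : ℝ), 0, s] := by
  funext i
  rw [stdSimplex_map_apply, Fin.sum_univ_two]
  fin_cases i <;> simp [edgePoint, Fin.succAbove, Fin.ext_iff]

/-- A homotopy `p · q ≃ r` of paths fills a singular `2`-simplex. -/
theorem exists_triangle {x y z : X} {p : Path x y} {q : Path y z} {r : Path x z}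
    (h : (p.trans q).Homotopic r) :
    ∃ σ : SingularSimplex X 2,
      (TopCat.toSSet.obj (TopCat.of X)).δ 2 σ = simplexOfPath p ∧
      (TopCat.toSSet.obj (TopCat.of X)).δ 0 σ = simplexOfPath q ∧
      (TopCat.toSSet.obj (TopCat.of X)).δ 1 σ = simplexOfPath r := by
  obtain ⟨H⟩ := h
  let sq : C(unitInterval × unitInterval, stdSimplex ℝ (Fin 3)) :=
    ⟨squareToTriangle, continuous_squareToTriangle⟩
  -- A continuous surjection from a compact space to a Hausdorff space is a quotient map. The
  -- homotopy is constant on the two collapsed sides, so it descends to the triangle.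
  have hq : IsQuotientMap sq :=
    IsQuotientMap.of_surjective_continuous squareToTriangle_surjective
      continuous_squareToTriangle
  have hfib (w w' : unitInterval × unitInterval) (hw : squareToTriangle w = squareToTriangle w') :
      H w = H w' := by
    obtain ⟨a, b⟩ := w
    obtain ⟨a', b'⟩ := w'
    obtain ⟨hb, h1⟩ := squareToTriangle_eq hw
    simp only at hb h1
    subst hb
    rcases h1 with rfl | rfl | rfl
    · rfl
    · rw [H.source, H.source]
    · rw [H.target, H.target]
  have hfac : Function.FactorsThrough (⟨H, H.continuous⟩ : C(unitInterval × unitInterval, X)) sq :=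
    fun w w' => hfib w w'
  let f : C(stdSimplex ℝ (Fin 3), X) := hq.lift ⟨H, H.continuous⟩ hfac
  have hf (w : unitInterval × unitInterval) : f (squareToTriangle w) = H w :=
    congrArg (fun k => k w) (hq.lift_comp ⟨H, H.continuous⟩ hfac)
  have hface (i : Fin 3) {a b : X} (g : Path a b) (c : unitInterval → unitInterval × unitInterval)
      (hc : ∀ s, squareToTriangle (c s) = stdSimplex.map i.succAbove (edgePoint s))
      (hg : ∀ s, H (c s) = g s) :
      (TopCat.toSSet.obj (TopCat.of X)).δ i (simplexMk f) = simplexOfPath g := by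
    refine eq_simplexOfPath fun s => ?_
    rw [simplexEval_face (simplexMk f) i, simplexEval_mk, ← hc, hf, hg]
  have hhalf (s : unitInterval) : (s : ℝ) / 2 ∈ unitInterval :=
    ⟨by linarith [s.2.1], by linarith [s.2.2]⟩
  have hhalf' (s : unitInterval) : (1 + s : ℝ) / 2 ∈ unitInterval :=
    ⟨by linarith [s.2.1], by linarith [s.2.2]⟩
  refine ⟨simplexMk f, hface 2 p (fun s => (0, ⟨_, hhalf s⟩)) (fun s => ?_) (fun s => ?_),
    hface 0 q (fun s => (0, ⟨_, hhalf' s⟩)) (fun s => ?_) (fun s => ?_),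
    hface 1 r (fun s => (1, s)) (fun s => ?_) (fun s => H.apply_one s)⟩
  · have hm : min ((s : ℝ) / 2) (1 - s / 2) = s / 2 := min_eq_left (by linarith [s.2.2])
    refine Subtype.ext ?_
    rw [map_edgePoint_two]
    funext i
    fin_cases i <;> simp [squareToTriangle, hm] <;> ring
  · rw [H.apply_zero]
    change (p.trans q) _ = p s
    rw [Path.trans_apply, dif_pos (by change (s : ℝ) / 2 ≤ 1 / 2; linarith [s.2.2])]
    congr 1
    exact Subtype.ext (by change 2 * ((s : ℝ) / 2) = s; ring)
  · have hm : min ((1 + s : ℝ) / 2) (1 - (1 + s) / 2) = (1 - s) / 2 := by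
      rw [min_eq_right (by linarith [s.2.1])]
      ring
    refine Subtype.ext ?_
    rw [map_edgePoint_zero]
    funext i
    fin_cases i <;> simp [squareToTriangle, hm] <;> ring
  · rw [H.apply_zero]
    change (p.trans q) _ = q s
    rw [Path.trans_apply]
    -- At `s = 0`, the midpoint of the concatenation, the value is computed by `p`, whose end is the
    -- start of `q`.
    split_ifs with h
    · have hs : (s : ℝ) = 0 := le_antisymm (by
        change (1 + s : ℝ) / 2 ≤ 1 / 2 at h
        linarith) s.2.1
      obtain rfl : s = 0 := Subtype.ext hs
      rw [q.source]
      convert p.target using 2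
      exact Subtype.ext (by simp)
    · congr 1
      exact Subtype.ext (by change 2 * ((1 + s : ℝ) / 2) - 1 = s; ring)
  · refine Subtype.ext ?_
    rw [map_edgePoint_one]
    simp [squareToTriangle]

end Simplices

/-! ### The first cohomology and the fundamental group -/

section Hurewicz

variable {X : Type u} [TopologicalSpace X]

/-- The class of a path, as an arrow of the fundamental groupoid. -/
def pathArrow {x y : X} (p : Path x y) : FundamentalGroupoid.mk x ⟶ FundamentalGroupoid.mk y :=
  Path.Homotopic.Quotient.mk p

theorem pathArrow_trans {x y z : X} (p : Path x y) (q : Path y z) :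
    pathArrow (p.trans q) = pathArrow p ≫ pathArrow q := rfl

theorem pathArrow_eq_iff {x y : X} {p q : Path x y} :
    pathArrow p = pathArrow q ↔ p.Homotopic q := Path.Homotopic.Quotient.eq

theorem pathArrow_surjective {x y : X} (a : FundamentalGroupoid.mk x ⟶ FundamentalGroupoid.mk y) :
    ∃ p : Path x y, pathArrow p = a := Path.Homotopic.Quotient.mk_surjective a

/-- A loop in a given class. -/
noncomputable def classLoop (x₀ : X) (g : FundamentalGroup X x₀) : Path x₀ x₀ :=
  (pathArrow_surjective g).choose

theorem pathArrow_classLoop (x₀ : X) (g : FundamentalGroup X x₀) : pathArrow (classLoop x₀ g) = g :=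
  (pathArrow_surjective g).choose_spec

/-- A loop in a given class, as a singular `1`-simplex. -/
noncomputable def classSimplex (x₀ : X) (g : FundamentalGroup X x₀) : SingularSimplex X 1 :=
  simplexOfPath (classLoop x₀ g)

/-- Multiplication in the fundamental group composes from right to left, so `h` is the front edge
and `g` the back edge. -/
theorem exists_triangle_classSimplex (x₀ : X) (g h : FundamentalGroup X x₀) :
    ∃ σ : SingularSimplex X 2,
      (TopCat.toSSet.obj (TopCat.of X)).δ 2 σ = classSimplex x₀ h ∧
      (TopCat.toSSet.obj (TopCat.of X)).δ 0 σ = classSimplex x₀ g ∧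
      (TopCat.toSSet.obj (TopCat.of X)).δ 1 σ = classSimplex x₀ (g * h) := by
  refine exists_triangle (pathArrow_eq_iff.mp ?_)
  rw [pathArrow_trans, pathArrow_classLoop, pathArrow_classLoop, pathArrow_classLoop]
  rfl

theorem mem_singularCocycles_one {a : SingularCochain (ZMod 2) X 1} :
    a ∈ singularCocycles (ZMod 2) X 1 ↔ ∀ σ : SingularSimplex X 2,
      a ((TopCat.toSSet.obj (TopCat.of X)).δ 1 σ) =
      a ((TopCat.toSSet.obj (TopCat.of X)).δ 0 σ) +
        a ((TopCat.toSSet.obj (TopCat.of X)).δ 2 σ) := by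
  rw [singularCocycles, LinearMap.mem_ker, funext_iff]
  refine forall_congr' fun σ => ?_
  rw [singularCoboundary_one_apply]
  change _ = (0 : ZMod 2) ↔ _
  constructor <;> intro h <;> linear_combination -h

theorem apply_simplexOfPath_of_triangle {a : SingularCochain (ZMod 2) X 1}
    (ha : a ∈ singularCocycles (ZMod 2) X 1) {x y z : X} {p : Path x y} {q : Path y z}
    {r : Path x z} (h : (p.trans q).Homotopic r) :
    a (simplexOfPath r) = a (simplexOfPath q) + a (simplexOfPath p) := by
  obtain ⟨σ, h2, h0, h1⟩ := exists_triangle h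
  rw [← h2, ← h0, ← h1]
  exact mem_singularCocycles_one.mp ha σ

/-- The value of a `0`-cochain on the endpoints of a path. -/
theorem singularCoboundary_zero_ofPath (b : X → ZMod 2) {x y : X} (p : Path x y) :
    singularCoboundary (ZMod 2) X 0 (fun τ => b (simplexEval τ default)) (simplexOfPath p) =
      b y - b x := by
  rw [singularCoboundary_zero_apply]
  have h (i : Fin 2) (s : unitInterval) (hs : stdSimplex.map i.succAbove default = edgePoint s) :
      simplexEval ((TopCat.toSSet.obj (TopCat.of X)).δ i (simplexOfPath p)) default = p s := by
    rw [simplexEval_face (simplexOfPath p) i, hs, simplexEval_ofPath]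
  have hd (i : Fin 2) : stdSimplex.map i.succAbove (default : stdSimplex ℝ (Fin 1)) =
      stdSimplex.vertex (i.succAbove 0) := by
    rw [← stdSimplex.map_vertex]
    exact congrArg _ (Subsingleton.elim _ _)
  rw [h 0 1 (by rw [hd, edgePoint_one]; rfl), h 1 0 (by rw [hd, edgePoint_zero]; rfl),
    p.source, p.target]

variable [PathConnectedSpace X] (x₀ : X)

open Classical in
/-- A path from the base point to each point, constant at the base point. -/
noncomputable def basePath (y : X) : Path x₀ y :=
  if h : y = x₀ then (Path.refl x₀).cast rfl h else PathConnectedSpace.somePath x₀ y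

theorem pathArrow_basePath_self : pathArrow (basePath x₀ x₀) = 𝟙 _ := by
  rw [basePath, dif_pos rfl]
  rfl

/-- The class of a path, as an element of the fundamental group. -/
noncomputable def pathClass {x y : X} (p : Path x y) : FundamentalGroup X x₀ :=
  pathArrow (basePath x₀ x) ≫ pathArrow p ≫ Groupoid.inv (pathArrow (basePath x₀ y))

theorem pathClass_mul {x y z : X} {p : Path x y} {q : Path y z} {r : Path x z}
    (h : (p.trans q).Homotopic r) : pathClass x₀ q * pathClass x₀ p = pathClass x₀ r := by
  rw [pathClass, pathClass, pathClass, ← pathArrow_eq_iff.mpr h, pathArrow_trans, End.mul_def]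
  simp

theorem pathClass_loop (p : Path x₀ x₀) : pathClass x₀ p = pathArrow p := by
  rw [pathClass, pathArrow_basePath_self]
  simp

/-- The class of a singular `1`-simplex, as an element of the fundamental group. -/
noncomputable def simplexClass (σ : SingularSimplex X 1) : FundamentalGroup X x₀ :=
  pathClass x₀ (simplexPath σ)

theorem pathClass_congr {x y x' y' : X} {p : Path x y} {q : Path x' y'} (h : ∀ s, p s = q s) :
    pathClass x₀ p = pathClass x₀ q := by
  obtain rfl : x = x' := by simpa using h 0
  obtain rfl : y = y' := by simpa using h 1
  rw [show p = q from Path.ext (funext h)]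

theorem simplexClass_ofPath {x y : X} (p : Path x y) :
    simplexClass x₀ (simplexOfPath p) = pathClass x₀ p :=
  pathClass_congr x₀ fun s => simplexEval_ofPath p s

/-- This makes `simplexClass` a nonabelian cocycle: pulling functions back along it turns group
coboundaries into singular ones. -/
theorem simplexClass_face (σ : SingularSimplex X 2) :
    simplexClass x₀ ((TopCat.toSSet.obj (TopCat.of X)).δ 0 σ) *
      simplexClass x₀ ((TopCat.toSSet.obj (TopCat.of X)).δ 2 σ) =
      simplexClass x₀ ((TopCat.toSSet.obj (TopCat.of X)).δ 1 σ) := by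
  obtain ⟨x, y, z, p, q, r, h, h2, h0, h1⟩ := exists_paths_of_triangle σ
  rw [h0, h1, h2, simplexClass_ofPath, simplexClass_ofPath, simplexClass_ofPath,
    pathClass_mul x₀ h]

theorem simplexClass_classSimplex (g : FundamentalGroup X x₀) :
    simplexClass x₀ (classSimplex x₀ g) = g := by
  rw [classSimplex, simplexClass_ofPath, pathClass_loop, pathArrow_classLoop]

/-- The cocycle of a homomorphism from the fundamental group to `ℤ/2`. -/
noncomputable def homCocycle :
    modTwoHoms (FundamentalGroup X x₀) →ₗ[ZMod 2] singularCocycles (ZMod 2) X 1 where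
  toFun f := ⟨fun σ => f.1 (simplexClass x₀ σ), mem_singularCocycles_one.mpr fun σ => by
    rw [← simplexClass_face]
    exact f.2 _ _⟩
  map_add' _ _ := rfl
  map_smul' _ _ := rfl

/-- The cohomology class of a homomorphism from the fundamental group to `ℤ/2`. -/
noncomputable def homClass :
    modTwoHoms (FundamentalGroup X x₀) →ₗ[ZMod 2] SingularCohomology (ZMod 2) X 1 :=
  Submodule.mkQ _ ∘ₗ homCocycle x₀

/-- A coboundary vanishes on loops, and every group element is the class of a loop. -/
theorem homClass_injective : Function.Injective (homClass x₀) := by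
  rw [← LinearMap.ker_eq_bot, LinearMap.ker_eq_bot']
  intro f hf
  have hf' := (Submodule.Quotient.mk_eq_zero _).mp hf
  obtain ⟨b, hb⟩ := LinearMap.mem_range.mp hf'
  refine Subtype.ext (funext fun g => ?_)
  have h := congrFun hb (classSimplex x₀ g)
  -- The standard `0`-simplex is a point, so a `0`-cochain is a function on `X`.
  have hb' : b = fun τ => b (simplexMk (ContinuousMap.const _ (simplexEval τ default))) := by
    funext τ
    congr 1
    refine simplexEval_injective (ContinuousMap.ext fun t => ?_)
    rw [simplexEval_mk]
    exact congrArg _ (Subsingleton.elim _ _)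
  rw [hb'] at h
  have h' := singularCoboundary_zero_ofPath
    (fun y => b (simplexMk (ContinuousMap.const _ y))) (classLoop x₀ g)
  rw [sub_self] at h'
  have h3 : f.1 (simplexClass x₀ (classSimplex x₀ g)) = 0 := h.symm.trans h'
  rwa [simplexClass_classSimplex] at h3

/-- The values of a cocycle on loops form a homomorphism; its values on the base paths form a
`0`-cochain whose coboundary is the discrepancy on arbitrary edges. -/
theorem homClass_surjective : Function.Surjective (homClass x₀) := by
  intro c
  obtain ⟨⟨a, ha⟩, rfl⟩ := Submodule.Quotient.mk_surjective _ c
  let f : modTwoHoms (FundamentalGroup X x₀) := ⟨fun g => a (classSimplex x₀ g), fun g h => by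
    obtain ⟨σ, h2, h0, h1⟩ := exists_triangle_classSimplex x₀ g h
    change a (classSimplex x₀ (g * h)) = a (classSimplex x₀ g) + a (classSimplex x₀ h)
    rw [← h2, ← h0, ← h1]
    exact mem_singularCocycles_one.mp ha σ⟩
  refine ⟨f, (Submodule.Quotient.eq _).mpr ?_⟩
  refine LinearMap.mem_range.mpr
    ⟨fun τ => a (simplexOfPath (basePath x₀ (simplexEval τ default))), funext fun σ => ?_⟩
  rw [← simplexOfPath_simplexPath σ]
  refine (singularCoboundary_zero_ofPath
    (fun y => a (simplexOfPath (basePath x₀ y))) (simplexPath σ)).trans ?_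
  set p := simplexPath σ
  -- The same class is reached by the base path followed by `p`, and by the loop of `p` followed by
  -- the base path to its end. Evaluating the cocycle on both triangles and comparing gives the
  -- claim.
  let r : Path x₀ _ := (basePath x₀ _).trans p
  have h1 : a (simplexOfPath r) = _ :=
    apply_simplexOfPath_of_triangle ha (p := basePath x₀ _) (q := p) (.refl _)
  have h2 : a (simplexOfPath r) = _ :=
    apply_simplexOfPath_of_triangle ha (p := classLoop x₀ (pathClass x₀ p))
      (q := basePath x₀ _) (pathArrow_eq_iff.mp (by
        rw [pathArrow_trans, pathArrow_classLoop, pathArrow_trans, pathClass]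
        simp))
  change _ = a (classSimplex x₀ (simplexClass x₀ (simplexOfPath p))) - a (simplexOfPath p)
  rw [simplexClass_ofPath, classSimplex]
  linear_combination h1 - h2 + CharTwo.two_eq_zero (R := ZMod 2) *
    (a (simplexOfPath p) - a (simplexOfPath (classLoop x₀ (pathClass x₀ p))))

/-- The first cohomology is the space of homomorphisms from the fundamental group to `ℤ/2`. -/
noncomputable def homClassEquiv :
    modTwoHoms (FundamentalGroup X x₀) ≃ₗ[ZMod 2] SingularCohomology (ZMod 2) X 1 :=
  LinearEquiv.ofBijective (homClass x₀) ⟨homClass_injective x₀, homClass_surjective x₀⟩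

theorem cupProduct_homClass (f g : modTwoHoms (FundamentalGroup X x₀)) :
    cupProduct (ZMod 2) X (homClass x₀ f) (homClass x₀ g) =
      Submodule.Quotient.mk ⟨cochainCup (ZMod 2) X 1 1 (homCocycle x₀ f) (homCocycle x₀ g),
        cochainCup_mem_cocycles (homCocycle x₀ f).2 (homCocycle x₀ g).2⟩ :=
  cupProduct_mk _ _ _ _

/-- The pointwise product of two cocycles is a primitive: mod 2 its coboundary is `f ∪ g + g ∪ f`.
-/
theorem cupProduct_homClass_comm (f g : modTwoHoms (FundamentalGroup X x₀)) :
    cupProduct (ZMod 2) X (homClass x₀ f) (homClass x₀ g) =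
      cupProduct (ZMod 2) X (homClass x₀ g) (homClass x₀ f) := by
  rw [cupProduct_homClass, cupProduct_homClass]
  refine (Submodule.Quotient.eq _).mpr (LinearMap.mem_range.mpr
    ⟨fun τ => (homCocycle x₀ f).1 τ * (homCocycle x₀ g).1 τ, funext fun σ => ?_⟩)
  rw [singularCoboundary_one_apply]
  have hf := mem_singularCocycles_one.mp (homCocycle x₀ f).2 σ
  have hg := mem_singularCocycles_one.mp (homCocycle x₀ g).2 σ
  change _ = cochainCup (ZMod 2) X 1 1 (homCocycle x₀ f) (homCocycle x₀ g) σ -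
    cochainCup (ZMod 2) X 1 1 (homCocycle x₀ g) (homCocycle x₀ f) σ
  rw [cochainCup_one_one_apply, cochainCup_one_one_apply, hf, hg]
  linear_combination -CharTwo.two_eq_zero (R := ZMod 2) *
    ((homCocycle x₀ f).1 ((TopCat.toSSet.obj (TopCat.of X)).δ 2 σ) *
      (homCocycle x₀ g).1 ((TopCat.toSSet.obj (TopCat.of X)).δ 0 σ))

/-! ### Cup products and quadratic cochains -/

section Cup

variable {x₀} {ι : Type*} [Fintype ι] [DecidableEq ι]

/-- The linear combinations of the cup products of a family of classes. -/
noncomputable def cupCombination (x : ι → modTwoHoms (FundamentalGroup X x₀)) :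
    (Sym2 ι → ZMod 2) →ₗ[ZMod 2] SingularCohomology (ZMod 2) X 2 where
  toFun u := ∑ s, u s • cupProduct (ZMod 2) X (homClass x₀ (x (Quot.out s).1))
    (homClass x₀ (x (Quot.out s).2))
  map_add' u w := by simp [add_smul, Finset.sum_add_distrib]
  map_smul' c u := by simp [mul_smul, Finset.smul_sum]

/-- The cocycle of a linear combination of cup products. -/
theorem cupCombination_eq_mk (x : ι → modTwoHoms (FundamentalGroup X x₀)) (u : Sym2 ι → ZMod 2) :
    ∃ z : singularCocycles (ZMod 2) X 2, cupCombination x u = Submodule.Quotient.mk z ∧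
      ∀ σ : SingularSimplex X 2, z.1 σ =
        quadCochain (fun i => (x i : FundamentalGroup X x₀ → ZMod 2)) u
          (simplexClass x₀ ((TopCat.toSSet.obj (TopCat.of X)).δ 2 σ))
          (simplexClass x₀ ((TopCat.toSSet.obj (TopCat.of X)).δ 0 σ)) := by
  refine ⟨∑ s, u s • ⟨cochainCup (ZMod 2) X 1 1 (homCocycle x₀ (x (Quot.out s).1))
    (homCocycle x₀ (x (Quot.out s).2)), cochainCup_mem_cocycles (homCocycle x₀ _).2
      (homCocycle x₀ _).2⟩, ?_, fun σ => ?_⟩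
  · change ∑ s, _ = Submodule.mkQ _ _
    rw [map_sum]
    rfl
  · simp only [AddSubmonoidClass.coe_finsetSum, Finset.sum_apply, quadCochain]
    refine Finset.sum_congr rfl fun s _ => ?_
    change u s * cochainCup (ZMod 2) X 1 1 _ _ σ = _
    rw [cochainCup_one_one_apply]
    rfl

/-- Evaluating a singular primitive on chosen loops gives a primitive on the group, and pulling a
group primitive back along `simplexClass` gives a singular one. On these classes this is the
injectivity of `H^2(Γ) → H^2(X)`. -/
theorem ker_cupCombination (x : ι → modTwoHoms (FundamentalGroup X x₀)) :
    LinearMap.ker (cupCombination x) = boundingCoeffs x := by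
  ext u
  obtain ⟨z, hz, hzσ⟩ := cupCombination_eq_mk x u
  rw [LinearMap.mem_ker, mem_boundingCoeffs, hz, Submodule.Quotient.mk_eq_zero]
  change z.1 ∈ LinearMap.range (singularCoboundary (ZMod 2) X 1) ↔ _
  have hcob (F : SingularCochain (ZMod 2) X 1) (σ : SingularSimplex X 2) :
      singularCoboundary (ZMod 2) X 1 F σ = z.1 σ ↔
      F ((TopCat.toSSet.obj (TopCat.of X)).δ 1 σ) =
        F ((TopCat.toSSet.obj (TopCat.of X)).δ 0 σ) +
        F ((TopCat.toSSet.obj (TopCat.of X)).δ 2 σ) +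
        quadCochain (fun i => (x i : FundamentalGroup X x₀ → ZMod 2)) u
          (simplexClass x₀ ((TopCat.toSSet.obj (TopCat.of X)).δ 2 σ))
          (simplexClass x₀ ((TopCat.toSSet.obj (TopCat.of X)).δ 0 σ)) := by
    rw [singularCoboundary_one_apply, hzσ]
    set q := quadCochain _ u _ _
    have h2 := CharTwo.two_eq_zero (R := ZMod 2)
    constructor <;> intro h
    · linear_combination -h - h2 * q
    · linear_combination -h - h2 * q
  constructor
  · rintro ⟨F, hF⟩
    refine ⟨fun g => F (classSimplex x₀ g), fun g h => ?_⟩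
    obtain ⟨σ, h2, h0, h1⟩ := exists_triangle_classSimplex x₀ g h
    have := (hcob F σ).mp (congrFun hF σ)
    rwa [h0, h1, h2, simplexClass_classSimplex, simplexClass_classSimplex] at this
  · rintro ⟨f, hf⟩
    refine ⟨fun τ => f (simplexClass x₀ τ), funext fun σ => (hcob _ σ).mpr ?_⟩
    rw [← simplexClass_face, hf]

theorem cupProduct_mem_range_cupCombination (x : ι → modTwoHoms (FundamentalGroup X x₀))
    (i j : ι) : cupProduct (ZMod 2) X (homClass x₀ (x i)) (homClass x₀ (x j)) ∈
      LinearMap.range (cupCombination x) := by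
  refine ⟨Pi.single s(i, j) 1, ?_⟩
  change ∑ s, _ = _
  rw [Finset.sum_eq_single s(i, j)]
  · rw [Pi.single_eq_same, one_smul]
    have h := sym2_mk_out s(i, j)
    rw [Sym2.eq_iff] at h
    rcases h with ⟨h1, h2⟩ | ⟨h1, h2⟩
    · rw [h1, h2]
    · rw [h1, h2, cupProduct_homClass_comm]
  · intro s _ hs
    rw [Pi.single_eq_of_ne hs, zero_smul]
  · simp

/-- Bilinearity reduces to products of basis elements, and symmetry allows one fixed order for each
pair. -/
theorem range_cupCombination (x : Module.Basis ι (ZMod 2) (modTwoHoms (FundamentalGroup X x₀))) :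
    LinearMap.range (cupCombination x) = cupSpan X := by
  apply le_antisymm
  · rintro _ ⟨u, rfl⟩
    exact Submodule.sum_mem _ fun s _ =>
      Submodule.smul_mem _ _ (Submodule.subset_span ⟨(_, _), rfl⟩)
  · refine Submodule.span_le.mpr ?_
    rintro _ ⟨⟨a, b⟩, rfl⟩
    obtain ⟨f, rfl⟩ := homClass_surjective x₀ a
    obtain ⟨g, rfl⟩ := homClass_surjective x₀ b
    change cupProduct (ZMod 2) X (homClass x₀ f) (homClass x₀ g) ∈ _
    rw [← x.sum_repr f, ← x.sum_repr g]
    simp only [map_sum, map_smul, LinearMap.sum_apply, LinearMap.smul_apply]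
    exact Submodule.sum_mem _ fun i _ => Submodule.smul_mem _ _ <|
      Submodule.sum_mem _ fun j _ => Submodule.smul_mem _ _ <|
        cupProduct_mem_range_cupCombination x _ _

/-- The dimension of the span of the cup products. -/
theorem finite_and_finrank_cupSpan
    (x : Module.Basis ι (ZMod 2) (modTwoHoms (FundamentalGroup X x₀))) :
    Module.Finite (ZMod 2) (cupSpan X) ∧
      Module.finrank (ZMod 2) (cupSpan X) + Module.finrank (ZMod 2) (boundingCoeffs x) =
        (Fintype.card ι + 1).choose 2 := by
  have h := (cupCombination x).finrank_range_add_finrank_ker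
  rw [ker_cupCombination, range_cupCombination x, Module.finrank_fintype_fun_eq_card,
    Sym2.card] at h
  refine ⟨?_, h⟩
  rw [← range_cupCombination x]
  infer_instance

end Cup

end Hurewicz

/-! ### The dual of the first homology -/

section DualHomology

/-! ### Cohomology as the dual of homology over a field -/

section

variable {k V₂ V₁ V₀ C₂ C₁ C₀ : Type*} [Field k] [AddCommGroup V₂] [AddCommGroup V₁]
  [AddCommGroup V₀] [Module k V₂] [Module k V₁] [Module k V₀] [AddCommGroup C₂] [AddCommGroup C₁]
  [AddCommGroup C₀] [Module k C₂] [Module k C₁] [Module k C₀]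
  {d₁ : V₁ →ₗ[k] V₀} {d₂ : V₂ →ₗ[k] V₁} (hd : ∀ v, d₁ (d₂ v) = 0)
  {δ₀ : C₀ →ₗ[k] C₁} {δ₁ : C₁ →ₗ[k] C₂}
  {E₀ : Module.Dual k V₀ ≃ₗ[k] C₀} {E₁ : Module.Dual k V₁ ≃ₗ[k] C₁}
  {E₂ : Module.Dual k V₂ ≃ₗ[k] C₂}
  (h₁ : ∀ φ, E₂ (φ ∘ₗ d₂) = δ₁ (E₁ φ))

theorem symm_comp_eq_zero (h₁ : ∀ φ, E₂ (φ ∘ₗ d₂) = δ₁ (E₁ φ)) (c : LinearMap.ker δ₁) : E₁.symm c.1 ∘ₗ d₂ = 0 := by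
  refine E₂.injective ?_
  rw [h₁, LinearEquiv.apply_symm_apply, map_zero]
  exact c.2

/-- The functional on the homology of `V₂ → V₁ → V₀` given by a cocycle. -/
def cocycleFunctional : LinearMap.ker δ₁ →ₗ[k] Module.Dual k
    (LinearMap.ker d₁ ⧸ LinearMap.range (d₂.codRestrict (LinearMap.ker d₁) hd)) where
  toFun c := Submodule.liftQ _ (E₁.symm c.1 ∘ₗ (LinearMap.ker d₁).subtype) (by
    rintro _ ⟨v, rfl⟩
    exact LinearMap.congr_fun (symm_comp_eq_zero h₁ c) v)
  map_add' c c' := by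
    refine Submodule.linearMap_qext _ (LinearMap.ext fun z => ?_)
    exact LinearMap.congr_fun (map_add E₁.symm c.1 c'.1) z.1
  map_smul' a c := by
    refine Submodule.linearMap_qext _ (LinearMap.ext fun z => ?_)
    exact LinearMap.congr_fun (map_smul E₁.symm a c.1) z.1

/-- Over a field, a functional on cycles extends to all chains; as it vanishes on boundaries, the
extension is a cocycle. -/
theorem cocycleFunctional_surjective : Function.Surjective (cocycleFunctional hd h₁) := by
  intro l
  obtain ⟨φ, hφ⟩ := LinearMap.exists_extend
    (l ∘ₗ (LinearMap.range (d₂.codRestrict (LinearMap.ker d₁) hd)).mkQ)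
  have hφd : φ ∘ₗ d₂ = 0 := LinearMap.ext fun v => by
    refine (LinearMap.congr_fun hφ (d₂.codRestrict (LinearMap.ker d₁) hd v)).trans ?_
    have h0 : (LinearMap.range (d₂.codRestrict (LinearMap.ker d₁) hd)).mkQ
        (d₂.codRestrict (LinearMap.ker d₁) hd v) = 0 :=
      (Submodule.Quotient.mk_eq_zero _).mpr (LinearMap.mem_range_self _ v)
    rw [LinearMap.comp_apply, h0, map_zero, LinearMap.zero_apply]
  refine ⟨⟨E₁ φ, ?_⟩, ?_⟩
  · rw [LinearMap.mem_ker, ← h₁, hφd, map_zero]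
  · refine Submodule.linearMap_qext _ (LinearMap.ext fun z => ?_)
    change E₁.symm (E₁ φ) z.1 = _
    rw [LinearEquiv.symm_apply_apply]
    exact LinearMap.congr_fun hφ z

/-- A functional vanishing on `ker d₁` factors through `d₁`, which means that it is a coboundary. -/
theorem ker_cocycleFunctional (h₀ : ∀ φ, E₁ (φ ∘ₗ d₁) = δ₀ (E₀ φ)) : LinearMap.ker (cocycleFunctional hd h₁) =
    (LinearMap.range δ₀).submoduleOf (LinearMap.ker δ₁) := by
  ext c
  rw [Submodule.submoduleOf, Submodule.mem_comap, LinearMap.mem_ker]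
  have h : cocycleFunctional hd h₁ c = 0 ↔ E₁.symm c.1 ∈ LinearMap.range d₁.dualMap := by
    rw [LinearMap.range_dualMap_eq_dualAnnihilator_ker, Submodule.mem_dualAnnihilator]
    constructor
    · intro h z hz
      exact LinearMap.congr_fun h (Submodule.Quotient.mk ⟨z, hz⟩)
    · intro h
      refine Submodule.linearMap_qext _ (LinearMap.ext fun z => ?_)
      exact h z.1 z.2
  rw [h]
  constructor
  · rintro ⟨φ, hφ⟩
    refine ⟨E₀ φ, ?_⟩
    rw [← h₀]
    exact (congrArg E₁ hφ).trans (E₁.apply_symm_apply _)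
  · rintro ⟨b, hb⟩
    refine ⟨E₀.symm b, E₁.injective ?_⟩
    rw [LinearEquiv.apply_symm_apply]
    refine (h₀ _).trans (Eq.trans ?_ hb)
    exact congrArg δ₀ (E₀.apply_symm_apply b)

/-- The cohomology of the dual complex is the dual of the homology. -/
noncomputable def cohomologyEquivDual (h₀ : ∀ φ, E₁ (φ ∘ₗ d₁) = δ₀ (E₀ φ)) :
    (LinearMap.ker δ₁ ⧸ (LinearMap.range δ₀).submoduleOf (LinearMap.ker δ₁)) ≃ₗ[k] Module.Dual k
      (LinearMap.ker d₁ ⧸ LinearMap.range (d₂.codRestrict (LinearMap.ker d₁) hd)) :=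
  (Submodule.quotEquivOfEq _ _ (ker_cocycleFunctional hd h₁ h₀).symm).trans
    ((cocycleFunctional hd h₁).quotKerEquivOfSurjective (cocycleFunctional_surjective hd h₁))

end

/-! ### The singular chain complex mod 2 and its dual -/

variable (X : Type u) [TopologicalSpace X]

/-- The singular chain complex of `X` with coefficients in `ℤ/2`. -/
noncomputable abbrev singularChainsModTwo : ChainComplex (ModuleCat.{u} (ZMod 2)) ℕ :=
  (TopCat.toSSet.obj (TopCat.of X)).chainComplex (ModuleCat.of (ZMod 2) (ULift.{u} (ZMod 2)))

/-- The basis element of the singular chains given by a singular simplex. -/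
noncomputable def simplexChain {n : ℕ} (σ : SingularSimplex X n) :
    (singularChainsModTwo X).X n :=
  ((TopCat.toSSet.obj (TopCat.of X)).ιChainComplex
    (R := ModuleCat.of (ZMod 2) (ULift.{u} (ZMod 2))) σ).hom (ULift.up 1)

theorem d_simplexChain {n : ℕ} (σ : SingularSimplex X (n + 1)) :
    ((singularChainsModTwo X).d (n + 1) n).hom (simplexChain X σ) =
      ∑ i : Fin (n + 2), (-1 : ZMod 2) ^ (i : ℕ) •
        simplexChain X ((TopCat.toSSet.obj (TopCat.of X)).δ i σ) := by
  have h := congrArg (fun f => f.hom (ULift.up (1 : ZMod 2))) (SSet.ιChainComplex_d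
    (TopCat.toSSet.obj (TopCat.of X)) (R := ModuleCat.of (ZMod 2) (ULift.{u} (ZMod 2))) σ)
  refine Eq.trans h ?_
  simp only [ModuleCat.hom_sum, LinearMap.sum_apply]
  refine Finset.sum_congr rfl fun i _ => ?_
  have hs : ((-1 : ℤ) ^ (i : ℕ) : ℤ) • simplexChain X ((TopCat.toSSet.obj (TopCat.of X)).δ i σ) =
    (-1 : ZMod 2) ^ (i : ℕ) • simplexChain X ((TopCat.toSSet.obj (TopCat.of X)).δ i σ) := by
    rw [← Int.cast_smul_eq_zsmul (ZMod 2)]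
    simp
  exact hs

/-- The chains are a coproduct of copies of the coefficients indexed by simplices, so a functional
can be prescribed freely on simplices. -/
theorem exists_chain_functional {n : ℕ} (c : SingularCochain (ZMod 2) X n) :
    ∃ φ : Module.Dual (ZMod 2) ((singularChainsModTwo X).X n),
      ∀ σ, φ (simplexChain X σ) = c σ := by
  let e : ULift.{u} (ZMod 2) ≃ₗ[ZMod 2] ZMod 2 := ULift.moduleEquiv
  let R := ModuleCat.of (ZMod 2) (ULift.{u} (ZMod 2))
  let Φ : (singularChainsModTwo X).X n ⟶ R :=
    ((TopCat.toSSet.obj (TopCat.of X)).isColimitChainComplexXCofan R n).desc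
      (Limits.Cofan.mk R fun σ => ModuleCat.ofHom (c σ • LinearMap.id))
  refine ⟨e.toLinearMap ∘ₗ Φ.hom, fun σ => ?_⟩
  have h := ((TopCat.toSSet.obj (TopCat.of X)).isColimitChainComplexXCofan R n).fac
    (Limits.Cofan.mk R fun σ => ModuleCat.ofHom (c σ • LinearMap.id)) ⟨σ⟩
  have h' := congrArg (fun f => e (f.hom (ULift.up (1 : ZMod 2)))) h
  exact h'.trans (mul_one (c σ))

theorem chain_functional_ext {n : ℕ} {φ ψ : Module.Dual (ZMod 2) ((singularChainsModTwo X).X n)}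
    (h : ∀ σ : SingularSimplex X n, φ (simplexChain X σ) = ψ (simplexChain X σ)) : φ = ψ := by
  let e : ULift.{u} (ZMod 2) ≃ₗ[ZMod 2] ZMod 2 := ULift.moduleEquiv
  have h' : ModuleCat.ofHom (e.symm.toLinearMap ∘ₗ φ) =
      ModuleCat.ofHom (e.symm.toLinearMap ∘ₗ ψ) := by
    refine SSet.chainComplex_hom_ext fun σ => ModuleCat.hom_ext (LinearMap.ext fun a => ?_)
    have ha : a = e a • ULift.up 1 := ULift.ext _ _ (mul_one _).symm
    rw [ha, map_smul, map_smul]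
    exact congrArg (fun b => e a • e.symm b) (h σ)
  refine LinearMap.ext fun v => e.symm.injective ?_
  exact LinearMap.congr_fun (congrArg ModuleCat.Hom.hom h') v

/-- A functional on the singular chains, as a singular cochain. -/
noncomputable def chainDualEquiv (n : ℕ) :
    Module.Dual (ZMod 2) ((singularChainsModTwo X).X n) ≃ₗ[ZMod 2] SingularCochain (ZMod 2) X n :=
  LinearEquiv.ofBijective
    { toFun := fun φ σ => φ (simplexChain X σ)
      map_add' := fun _ _ => rfl
      map_smul' := fun _ _ => rfl }
    ⟨fun _ _ h => chain_functional_ext X fun σ => congrFun h σ, fun c => by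
      obtain ⟨φ, hφ⟩ := exists_chain_functional X c
      exact ⟨φ, funext hφ⟩⟩

theorem chainDualEquiv_d (n : ℕ) (φ : Module.Dual (ZMod 2) ((singularChainsModTwo X).X n)) :
    chainDualEquiv X (n + 1) (φ ∘ₗ ((singularChainsModTwo X).d (n + 1) n).hom) =
      singularCoboundary (ZMod 2) X n (chainDualEquiv X n φ) := by
  funext σ
  change φ (((singularChainsModTwo X).d (n + 1) n).hom (simplexChain X σ)) = _
  rw [d_simplexChain, map_sum]
  refine Finset.sum_congr rfl fun i _ => ?_
  rw [map_smul]
  rfl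

theorem singularChains_d_d (v : (singularChainsModTwo X).X 2) :
    ((singularChainsModTwo X).d 1 0).hom (((singularChainsModTwo X).d 2 1).hom v) = 0 :=
  ((singularChainsModTwo X).sc' 2 1 0).moduleCat_zero_apply v

/-- The singular homology, as a quotient of the cycles. -/
noncomputable def homologyOneEquiv : singularHomologyModTwo 1 X ≃ₗ[ZMod 2]
    LinearMap.ker ((singularChainsModTwo X).d 1 0).hom ⧸
      LinearMap.range (((singularChainsModTwo X).d 2 1).hom.codRestrict
        (LinearMap.ker ((singularChainsModTwo X).d 1 0).hom) (singularChains_d_d X)) :=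
  ((ShortComplex.homologyMapIso ((singularChainsModTwo X).isoSc' 2 1 0 (by simp) (by simp))) ≪≫
    ((singularChainsModTwo X).sc' 2 1 0).moduleCatHomologyIso).toLinearEquiv

/-- The first cohomology is the dual of the first homology. -/
noncomputable def cohomologyDualEquiv : SingularCohomology (ZMod 2) X 1 ≃ₗ[ZMod 2]
    Module.Dual (ZMod 2) (singularHomologyModTwo 1 X) :=
  (cohomologyEquivDual (singularChains_d_d X) (chainDualEquiv_d X 1) (chainDualEquiv_d X 0)).trans
    (homologyOneEquiv X).dualMap

/-- The first homology is dual to the space of homomorphisms from the fundamental group. -/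
noncomputable def modTwoHomsDualEquiv {X : Type u} [TopologicalSpace X] [PathConnectedSpace X]
    (x₀ : X) : modTwoHoms (FundamentalGroup X x₀) ≃ₗ[ZMod 2]
      Module.Dual (ZMod 2) (singularHomologyModTwo 1 X) :=
  (homClassEquiv x₀).trans (cohomologyDualEquiv X)

theorem finite_singularHomology {X : Type u} [TopologicalSpace X] [PathConnectedSpace X]
    (x₀ : X) [Module.Finite (ZMod 2) (modTwoHoms (FundamentalGroup X x₀))] :
    Module.Finite (ZMod 2) (singularHomologyModTwo 1 X) :=
  (Module.finite_dual_iff (ZMod 2)).mp (Module.Finite.equiv (modTwoHomsDualEquiv x₀))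

theorem rkModTwo_eq {X : Type u} [TopologicalSpace X] [PathConnectedSpace X] (x₀ : X) :
    rkModTwo X = Module.finrank (ZMod 2) (modTwoHoms (FundamentalGroup X x₀)) := by
  rw [(modTwoHomsDualEquiv x₀).finrank_eq]
  exact (Subspace.dual_finrank_eq).symm

end DualHomology

/-! ### Finite generation of the fundamental group -/

section FiniteGeneration

open unitInterval

variable {X : Type u} [TopologicalSpace X]

theorem pathArrow_eq_of_simplyConnected {Y : Type v} [TopologicalSpace Y] [SimplyConnectedSpace Y]
    {f : Y → X} (hf : Continuous f) {y z : Y} (p q : Path y z) :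
    pathArrow (p.map hf) = pathArrow (q.map hf) :=
  pathArrow_eq_iff.mpr ((SimplyConnectedSpace.paths_homotopic p q).map ⟨f, hf⟩)

theorem pathArrow_map_trans {Y : Type v} [TopologicalSpace Y] {f : Y → X} (hf : Continuous f)
    {y z w : Y} (p : Path y z) (q : Path z w) :
    pathArrow ((p.trans q).map hf) = pathArrow (p.map hf) ≫ pathArrow (q.map hf) := by
  rw [Path.map_trans, pathArrow_trans]

/-- A choice of classes of paths from `x₀` to all the points is parallel on `U` if it is compatible
with the paths inside `U`. -/
def IsParallelOn {x₀ : X} (U : Set X)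
    (g : ∀ y : X, FundamentalGroupoid.mk x₀ ⟶ FundamentalGroupoid.mk y) : Prop :=
  ∀ ⦃y y' : X⦄ (w : Path y y'), (∀ s, w s ∈ U) → g y ≫ pathArrow w = g y'

-- Take a path to one point of `U` and continue inside `U`; simple connectedness makes the class
-- independent of the continuation. The values outside `U` are arbitrary.
open Classical in
theorem exists_isParallelOn [PathConnectedSpace X] (x₀ : X) (U : Set X) [SimplyConnectedSpace U] :
    ∃ g : ∀ y : X, FundamentalGroupoid.mk x₀ ⟶ FundamentalGroupoid.mk y, IsParallelOn U g := by
  obtain ⟨c⟩ : Nonempty U := inferInstance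
  refine ⟨fun y => if hy : y ∈ U then pathArrow (PathConnectedSpace.somePath x₀ c.1) ≫
    pathArrow ((PathConnectedSpace.somePath c ⟨y, hy⟩).map continuous_subtype_val)
    else pathArrow (PathConnectedSpace.somePath x₀ y), fun y y' w hw => ?_⟩
  have hy : y ∈ U := by simpa using hw 0
  have hy' : y' ∈ U := by simpa using hw 1
  let w' : Path (⟨y, hy⟩ : U) ⟨y', hy'⟩ :=
    { toFun := fun s => ⟨w s, hw s⟩
      continuous_toFun := w.continuous.subtype_mk _
      source' := Subtype.ext w.source
      target' := Subtype.ext w.target }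
  have h : pathArrow w = pathArrow (w'.map continuous_subtype_val) := rfl
  simp only [dif_pos hy, dif_pos hy']
  rw [Category.assoc, h, ← pathArrow_map_trans]
  exact congrArg _ (pathArrow_eq_of_simplyConnected _ _ _)

variable {x₀ : X}

/-- The transition function between two choices of classes of paths. -/
noncomputable def transition (g g' : ∀ y : X, FundamentalGroupoid.mk x₀ ⟶ FundamentalGroupoid.mk y) (y : X) :
    FundamentalGroup X x₀ :=
  g y ≫ Groupoid.inv (g' y)

/-- A short path inside `U ∩ U'` changes both choices by the same class, which cancels. -/
theorem eventually_transition_eq [LocallyPathConnectedSpace X] {U U' : Set X} (hU : IsOpen U)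
    (hU' : IsOpen U') {g g' : ∀ y : X, FundamentalGroupoid.mk x₀ ⟶ FundamentalGroupoid.mk y}
    (hg : IsParallelOn U g) (hg' : IsParallelOn U' g') {y : X} (hy : y ∈ U) (hy' : y ∈ U') :
    ∀ᶠ z in 𝓝 y, transition g g' z = transition g g' y := by
  obtain ⟨W, ⟨hW, hWc⟩, hWU⟩ := (path_connected_basis y).mem_iff.mp
    (Filter.inter_mem (hU.mem_nhds hy) (hU'.mem_nhds hy'))
  filter_upwards [hW] with z hz
  obtain ⟨w, hw⟩ := hWc.joinedIn y (mem_of_mem_nhds hW) z hz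
  rw [transition, transition, ← hg w fun s => (hWU (hw s)).1, ← hg' w fun s => (hWU (hw s)).2]
  simp

theorem finite_image_of_eventually_eq {α : Type*} {f : X → α} {K : Set X} (hK : IsCompact K)
    (h : ∀ y ∈ K, ∀ᶠ z in 𝓝 y, f z = f y) : (f '' K).Finite := by
  obtain ⟨t, -, ht⟩ := hK.elim_nhds_subcover (fun y => {z | f z = f y}) h
  refine (t.finite_toSet.image f).subset ?_
  rintro _ ⟨z, hz, rfl⟩
  obtain ⟨y, hy, hzy⟩ := Set.mem_iUnion₂.mp (ht hz)
  exact ⟨y, hy, hzy.symm⟩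

/-- The holonomy along a path `p`, with the two ends carried to the base point by `a` and `g`. -/
noncomputable def holonomy (g : ∀ y : X, FundamentalGroupoid.mk x₀ ⟶ FundamentalGroupoid.mk y) {y z : X}
    (a : FundamentalGroupoid.mk x₀ ⟶ FundamentalGroupoid.mk y) (p : Path y z) :
    FundamentalGroup X x₀ :=
  g z ≫ Groupoid.inv (a ≫ pathArrow p)

/-- A change of choice at the end multiplies the holonomy on the right by a transition element, so
its left coset modulo the transitions is unaffected. -/
theorem holonomy_inv_mul_holonomy
    (g g' : ∀ y : X, FundamentalGroupoid.mk x₀ ⟶ FundamentalGroupoid.mk y) {y z : X}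
    (a : FundamentalGroupoid.mk x₀ ⟶ FundamentalGroupoid.mk y) (p : Path y z) :
    (holonomy g a p)⁻¹ * holonomy g' a p = transition g' g z := by
  rw [inv_mul_eq_iff_eq_mul, End.mul_def, holonomy, holonomy, transition]
  simp

theorem holonomy_trans {U : Set X}
    {g : ∀ y : X, FundamentalGroupoid.mk x₀ ⟶ FundamentalGroupoid.mk y} (hg : IsParallelOn U g)
    {y z z' : X} (a : FundamentalGroupoid.mk x₀ ⟶ FundamentalGroupoid.mk y) (p : Path y z)
    (w : Path z z') (hw : ∀ s, w s ∈ U) : holonomy g a (p.trans w) = holonomy g a p := by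
  rw [holonomy, holonomy, ← hg w hw, pathArrow_trans]
  simp

theorem holonomy_congr (g : ∀ y : X, FundamentalGroupoid.mk x₀ ⟶ FundamentalGroupoid.mk y)
    {y z : X} (a : FundamentalGroupoid.mk x₀ ⟶ FundamentalGroupoid.mk y) {p q : Path y z}
    (h : pathArrow p = pathArrow q) : holonomy g a p = holonomy g a q := by
  rw [holonomy, holonomy, h]

instance simplyConnectedSpace_unitInterval : SimplyConnectedSpace I :=
  have : ContractibleSpace I := (convex_Icc (0 : ℝ) 1).contractibleSpace ⟨0, by simp⟩
  inferInstance

instance locallyPathConnectedSpace_unitInterval : LocallyPathConnectedSpace I :=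
  (convex_Icc (0 : ℝ) 1).locallyPathConnectedSpace

variable {ι : Type*} [Finite ι] {U V : ι → Set X}
  {g : ι → ∀ y : X, FundamentalGroupoid.mk x₀ ⟶ FundamentalGroupoid.mk y}

/-- The coset of the holonomy is followed along the path. A short piece stays in one `U i`, where
parallelism leaves the holonomy unchanged, and a change of index stays within the coset of `H`. So
the coset is locally constant in time, hence constant. -/
theorem holonomy_coset_eq (hU : ∀ i, IsOpen (U i)) (hV : ∀ i, IsClosed (V i))
    (hVU : ∀ i, V i ⊆ U i) (hcov : ∀ y, ∃ i, y ∈ V i) (hg : ∀ i, IsParallelOn (U i) (g i))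
    {H : Subgroup (FundamentalGroup X x₀)}
    (hH : ∀ i j, ∀ y ∈ V i ∩ V j, transition (g i) (g j) y ∈ H) {y z : X}
    (a : FundamentalGroupoid.mk x₀ ⟶ FundamentalGroupoid.mk y) (p : Path y z) {i j : ι}
    (hi : y ∈ V i) (hj : z ∈ V j) :
    (holonomy (g i) a (Path.refl y) : FundamentalGroup X x₀ ⧸ H) = holonomy (g j) a p := by
  obtain ⟨f, rfl, rfl⟩ := p
  have hf : Continuous f := f.continuous
  have hind {y z : X} (a : FundamentalGroupoid.mk x₀ ⟶ FundamentalGroupoid.mk y) (p : Path y z)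
      {i j : ι} (hi : z ∈ V i) (hj : z ∈ V j) :
      (holonomy (g i) a p : FundamentalGroup X x₀ ⧸ H) = holonomy (g j) a p := by
    rw [QuotientGroup.eq, holonomy_inv_mul_holonomy]
    exact hH j i z ⟨hj, hi⟩
  let P (s : I) : Path (f 0) (f s) := (PathConnectedSpace.somePath 0 s).map hf
  choose J hJ using hcov
  let F (s : I) : FundamentalGroup X x₀ ⧸ H := (holonomy (g (J (f s))) a (P s) :)
  have hF : IsLocallyConstant F := by
    rw [IsLocallyConstant.iff_eventually_eq]
    intro s
    -- Openness of `U k` keeps nearby points in it, while closedness of `V k` keeps nearby points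
    -- out of any `V k` that misses `f s`.
    have hN : (⋂ k, {s' | (f s ∈ V k → f s' ∈ U k) ∧ (f s' ∈ V k → f s ∈ V k)}) ∈ 𝓝 s := by
      refine (Filter.iInter_mem).mpr fun k => ?_
      by_cases hk : f s ∈ V k
      · filter_upwards [hf.continuousAt.preimage_mem_nhds ((hU k).mem_nhds (hVU k hk))] with s' hs'
        exact ⟨fun _ => hs', fun _ => hk⟩
      · filter_upwards [hf.continuousAt.preimage_mem_nhds ((hV k).isOpen_compl.mem_nhds hk)]
          with s' hs'
        exact ⟨fun h => absurd h hk, fun h => absurd h hs'⟩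
    obtain ⟨W, ⟨hW, hWc⟩, hWN⟩ := (path_connected_basis s).mem_iff.mp hN
    filter_upwards [hW] with s' hs'
    obtain ⟨w, hw⟩ := hWc.joinedIn s (mem_of_mem_nhds hW) s' hs'
    have hs : f s ∈ V (J (f s')) := (Set.mem_iInter.mp (hWN hs') _).2 (hJ _)
    refine Eq.trans (congrArg QuotientGroup.mk ?_) (hind a (P s) (i := J (f s')) hs (hJ _))
    refine (holonomy_congr _ a ?_).trans (holonomy_trans (hg _) a (P s) (w.map hf) fun r =>
      (Set.mem_iInter.mp (hWN (hw r)) _).1 hs)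
    rw [← Path.map_trans]
    exact pathArrow_eq_of_simplyConnected _ _ _
  have h01 : F 0 = F 1 := hF.apply_eq_of_preconnectedSpace 0 1
  have h0 : pathArrow (Path.refl (f 0)) = pathArrow (P 0) :=
    pathArrow_eq_of_simplyConnected hf (Path.refl 0) _
  let q : Path (0 : I) 1 := ⟨ContinuousMap.id I, rfl, rfl⟩
  have h1 : pathArrow (⟨f, rfl, rfl⟩ : Path (f 0) (f 1)) = pathArrow (P 1) :=
    pathArrow_eq_of_simplyConnected hf q _
  exact ((congrArg QuotientGroup.mk (holonomy_congr _ a h0)).trans (hind a (P 0) hi (hJ _))).trans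
    (h01.trans ((hind a (P 1) (hJ _) hj).trans (congrArg QuotientGroup.mk (holonomy_congr _ a h1.symm))))

/-- The generators are the transitions on the overlaps `V i ∩ V j`: they are locally constant on
compact sets, so finite in number. Comparing holonomies around loops shows that they generate, up to
conjugation by `b`. -/
theorem fundamentalGroup_fg_of_cover [CompactSpace X] [LocallyPathConnectedSpace X]
    (hU : ∀ i, IsOpen (U i)) (hV : ∀ i, IsClosed (V i))
    (hVU : ∀ i, V i ⊆ U i) (hcov : ∀ y, ∃ i, y ∈ V i) (hg : ∀ i, IsParallelOn (U i) (g i)) :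
    Group.FG (FundamentalGroup X x₀) := by
  let S : Set (FundamentalGroup X x₀) :=
    ⋃ i, ⋃ j, transition (g i) (g j) '' (V i ∩ V j)
  have hS : S.Finite := Set.finite_iUnion fun i => Set.finite_iUnion fun j =>
    finite_image_of_eventually_eq ((hV i).inter (hV j)).isCompact fun y hy =>
      eventually_transition_eq (hU i) (hU j) (hg i) (hg j) (hVU i hy.1) (hVU j hy.2)
  let H := Subgroup.closure S
  have hH : ∀ i j, ∀ y ∈ V i ∩ V j, transition (g i) (g j) y ∈ H := fun i j y hy =>
    Subgroup.subset_closure (Set.mem_iUnion₂.mpr ⟨i, j, y, hy, rfl⟩)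
  obtain ⟨i, hi⟩ := hcov x₀
  let b : FundamentalGroup X x₀ := g i x₀
  have key (c : FundamentalGroup X x₀) : b⁻¹ * c⁻¹ * b ∈ H := by
    obtain ⟨p, rfl⟩ := pathArrow_surjective c
    have h := holonomy_coset_eq hU hV hVU hcov hg hH (𝟙 _) p hi hi
    have e1 : holonomy (g i) (𝟙 _) (Path.refl x₀) = b := by
      have : pathArrow (Path.refl x₀) = 𝟙 _ := rfl
      rw [holonomy, this]
      simp [b]
    have e2 : holonomy (g i) (𝟙 _) p = (show FundamentalGroup X x₀ from pathArrow p)⁻¹ * b := by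
      rw [End.mul_def, holonomy, Category.id_comp]
      rfl
    rw [QuotientGroup.eq, e1, e2] at h
    simpa [mul_assoc] using h
  have hT : H = ⊤ := by
    refine (Subgroup.eq_top_iff' H).mpr fun c => ?_
    have h : b⁻¹ * (b * c⁻¹ * b⁻¹)⁻¹ * b = c := by group
    exact h ▸ key (b * c⁻¹ * b⁻¹)
  exact ⟨(Subgroup.fg_iff _).mpr ⟨S, hT, hS⟩⟩

theorem fundamentalGroup_fg [CompactSpace X] [T2Space X] [PathConnectedSpace X]
    [LocallyPathConnectedSpace X] (h : ∀ x : X, ∃ U ∈ 𝓝 x, SimplyConnectedSpace U) (x₀ : X) :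
    Group.FG (FundamentalGroup X x₀) := by
  have h' (x : X) : ∃ U : Set X, IsOpen U ∧ x ∈ U ∧
      ∃ g : ∀ y : X, FundamentalGroupoid.mk x₀ ⟶ FundamentalGroupoid.mk y, IsParallelOn U g := by
    obtain ⟨U, hU, hs⟩ := h x
    obtain ⟨g, hg⟩ := exists_isParallelOn x₀ U
    exact ⟨interior U, isOpen_interior, mem_interior_iff_mem_nhds.mpr hU, g,
      fun y y' w hw => hg w fun s => interior_subset (hw s)⟩
  choose U hU hx g hg using h'
  choose V hV hVc hVU using fun x => exists_mem_nhds_isClosed_subset ((hU x).mem_nhds (hx x))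
  obtain ⟨t, ht⟩ := CompactSpace.elim_nhds_subcover V hV
  exact fundamentalGroup_fg_of_cover (ι := t) (U := fun i => U i) (V := fun i => V i)
    (g := fun i => g i) (fun i => hU i) (fun i => hVc i) (fun i => hVU i)
    (fun y => by
      obtain ⟨i, hi, hy⟩ := Set.mem_iUnion₂.mp (ht.ge (Set.mem_univ y))
      exact ⟨⟨i, hi⟩, hy⟩) fun i => hg i

theorem exists_simplyConnected_nhd {H : Type v} [NormedAddCommGroup H] [NormedSpace ℝ H]
    [ChartedSpace H X] (x : X) : ∃ U ∈ 𝓝 x, SimplyConnectedSpace U := by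
  let φ := chartAt H x
  obtain ⟨ε, hε, hb⟩ := Metric.isOpen_iff.mp φ.open_target (φ x) (mem_chart_target H x)
  refine ⟨φ.symm '' Metric.ball (φ x) ε, ?_, ?_⟩
  · have h := φ.symm.image_mem_nhds (mem_chart_target H x) (Metric.ball_mem_nhds (φ x) hε)
    rwa [φ.left_inv (mem_chart_source H x)] at h
  · have : ContractibleSpace (Metric.ball (φ x) ε) := Metric.contractibleSpace_ball hε
    have e := φ.symm.homeomorphOfImageSubsetSource (s := Metric.ball (φ x) ε) hb rfl
    have := e.symm.contractibleSpace
    infer_instance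

end FiniteGeneration

/-! ### Regular coverings -/

section RegularCovering

variable {E : Type v} {X : Type u} [TopologicalSpace E] [TopologicalSpace X] {p : E → X}

theorem IsLocalHomeomorph.locallyPathConnectedSpace (hp : IsLocalHomeomorph p)
    [LocallyPathConnectedSpace X] : LocallyPathConnectedSpace E := by
  choose φ hφ _ using hp
  let _ : ChartedSpace X E :=
    { atlas := Set.range φ
      chartAt := φ
      mem_chart_source := hφ
      chart_mem_atlas := fun e => ⟨e, rfl⟩ }
  exact ChartedSpace.locallyPathConnectedSpace X E

instance deckGroupAction (p : E → X) : MulAction (deckGroup p) E where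
  smul h e := h.1 e
  one_smul _ := rfl
  mul_smul _ _ _ := rfl

/-- Deck transformations act freely by uniqueness of lifts on the connected space `E`, and
regularity makes the fibres their orbits. -/
theorem IsRegularCovering.isQuotientCoveringMap (hp : IsRegularCovering p) :
    IsQuotientCoveringMap p (deckGroup p) := by
  have := hp.connected
  refine (isQuotientCoveringMap_iff_isCoveringMap_and ..).mpr
    ⟨hp.isCoveringMap, hp.surjective, ⟨fun h => h.1.continuous⟩, ?_, fun {e₁ e₂} => ⟨?_, ?_⟩⟩
  · exact
      { left_cancel' := fun h _ _ he => h.1.injective he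
        right_cancel' := fun h k e he => Subtype.ext <| Homeomorph.ext <| congrFun <|
          hp.isCoveringMap.eq_of_comp_eq h.1.continuous k.1.continuous
            (funext fun e => (h.2 e).trans (k.2 e).symm) e he }
  · intro he
    obtain ⟨h, hh, he⟩ := hp.transitive e₂ e₁ he.symm
    exact ⟨⟨h, hh⟩, he⟩
  · rintro ⟨h, rfl⟩
    exact h.2 e₂

/-- Monodromy maps the fundamental group of the base onto the opposite of the deck group, with
kernel the image of the fundamental group of `E`, which injects by homotopy lifting. Commutativity
of `A` absorbs the opposite. -/
theorem IsRegularCovering.exists_fundamentalGroup_equiv_ker [PathConnectedSpace E]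
    (hp : IsRegularCovering p) {A : Type*} [CommGroup A] (f : deckGroup p ≃* A) (e : E) :
    ∃ π : FundamentalGroup X (p e) →* A, Function.Surjective π ∧
      Nonempty (FundamentalGroup E e ≃* π.ker) := by
  have hq := hp.isQuotientCoveringMap
  let e' : p ⁻¹' {p e} := ⟨e, rfl⟩
  let ψ : (deckGroup p)ᵐᵒᵖ ≃* A :=
    { toFun := fun h => f h.unop
      invFun := fun a => MulOpposite.op (f.symm a)
      left_inv := fun h => by simp
      right_inv := fun a => by simp
      map_mul' := fun h k => by simp [mul_comm] }
  let π := ψ.toMonoidHom.comp (hq.fundamentalGroupToMulOpposite e')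
  have hker : π.ker = (FundamentalGroup.mapOfEq ⟨p, hq.continuous⟩ e'.2).range := by
    rw [← hq.ker_monodromyPerm e', ← hq.ker_fundamentalGroupToMulOpposite e']
    ext c
    simp [π, MonoidHom.mem_ker]
  have hinj : Function.Injective
      (FundamentalGroup.mapOfEq (x := e) ⟨p, hq.continuous⟩ e'.2) := by
    intro a b hab
    refine hq.isCoveringMap.injective_path_homotopic_map e e ?_
    have h := (FundamentalGroup.mapOfEq_apply ⟨p, hq.continuous⟩ rfl a).symm.trans
      (hab.trans (FundamentalGroup.mapOfEq_apply ⟨p, hq.continuous⟩ rfl b))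
    rwa [Path.Homotopic.Quotient.cast_rfl_rfl, Path.Homotopic.Quotient.cast_rfl_rfl] at h
  exact ⟨π, ψ.surjective.comp (hq.fundamentalGroupToMulOpposite_surjective e'),
    ⟨(MonoidHom.ofInjective hinj).trans (MulEquiv.subgroupCongr hker.symm)⟩⟩

end RegularCovering

/-! ### The dimension formula and the bound for coverings -/

theorem finite_and_finrank_layer_eq (X : Type u) [TopologicalSpace X] [PathConnectedSpace X] (x : X)
    [Module.Finite (ZMod 2) (modTwoHoms (FundamentalGroup X x))] :
    Module.Finite (ZMod 2) (cupSpan X) ∧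
      Module.Finite (ZMod 2) (ModTwoLayer (FundamentalGroup X x) 1) ∧
      Module.finrank (ZMod 2) (ModTwoLayer (FundamentalGroup X x) 1) +
        Module.finrank (ZMod 2) (cupSpan X) = (rkModTwo X + 1).choose 2 := by
  let b := Module.finBasis (ZMod 2) (modTwoHoms (FundamentalGroup X x))
  obtain ⟨h1, h2⟩ := finite_and_finrank_cupSpan b
  obtain ⟨h3, h4⟩ := finite_and_finrank_layer b
  refine ⟨h1, h3, ?_⟩
  rw [h4, rkModTwo_eq x, add_comm, h2, Fintype.card_fin]

theorem cast_succ_choose_two (n : ℕ) : ((n + 1).choose 2 : ℚ) = n * (n + 1) / 2 := by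
  rw [Nat.cast_choose_two]
  push_cast
  ring

theorem finite_and_le_rkModTwo {X : Type u} [TopologicalSpace X] [PathConnectedSpace X]
    [LocallyPathConnectedSpace X] (hfg : ∀ x : X, Group.FG (FundamentalGroup X x)) {m : ℕ}
    {E : Type v} [TopologicalSpace E] {p : E → X} (hp : IsRegularCovering p)
    (f : deckGroup p ≃* Multiplicative (Fin m → ZMod 2)) :
    Module.Finite (ZMod 2) (singularHomologyModTwo 1 E) ∧
      ((m : ℚ) + 1) * (rkModTwo X : ℚ) - (m : ℚ) * ((m : ℚ) + 1) / 2 -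
        (Module.finrank (ZMod 2) (cupSpan X) : ℚ) ≤ rkModTwo E := by
  have := hp.connected
  have := hp.isCoveringMap.isLocalHomeomorph.locallyPathConnectedSpace
  have : PathConnectedSpace E := .of_locallyPathConnectedSpace
  obtain ⟨e⟩ : Nonempty E := inferInstance
  obtain ⟨π, hπ, ⟨i⟩⟩ := hp.exists_fundamentalGroup_equiv_ker f e
  have := hfg (p e)
  have := finite_modTwoHoms_of_fg (FundamentalGroup X (p e))
  have : Finite (Multiplicative (Fin m → ZMod 2)) := inferInstanceAs (Finite (Fin m → ZMod 2))
  -- A subgroup of finite index in a finitely generated group is finitely generated, which gives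
  -- finiteness for the covering.
  have : π.ker.FiniteIndex := inferInstance
  have := finite_modTwoHoms_of_fg π.ker
  have : Module.Finite (ZMod 2) (modTwoHoms (FundamentalGroup E e)) :=
    Module.Finite.equiv (modTwoHomsCongr i)
  refine ⟨finite_singularHomology e, ?_⟩
  obtain ⟨k, hk, hle⟩ := finrank_modTwoHoms_ker hπ
  obtain ⟨-, -, hd⟩ := finite_and_finrank_layer_eq X (p e)
  rw [← (modTwoHomsCongr i).finrank_eq.symm, ← rkModTwo_eq e] at hle
  rw [← rkModTwo_eq (p e)] at hk
  -- With `r = m + k`, the bound obtained is `(r+1 choose 2) - t + k - (k+1 choose 2)`, which equals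
  -- the stated expression as a polynomial in `m` and `k`.
  rw [hk] at hd ⊢
  have hd' := congrArg (Nat.cast (R := ℚ)) hd
  have hle' := Nat.cast_le (α := ℚ) |>.mpr hle
  push_cast [cast_succ_choose_two] at hd' hle' ⊢
  linarith

theorem mainTheorem10 {M : Type u} [TopologicalSpace M] [T2Space M] [CompactSpace M]
    [ChartedSpace (EuclideanSpace ℝ (Fin 3)) M] (hM : IsAspherical M) :
    -- the dimensions `r` and `t` are finite
    Module.Finite (ZMod 2) (singularHomologyModTwo 1 M) ∧
    Module.Finite (ZMod 2) (cupSpan M) ∧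
    -- the dimension of `Γ_1 / Γ_2`
    (∀ x : M, Module.Finite (ZMod 2) (ModTwoLayer (FundamentalGroup M x) 1) ∧
      (Module.finrank (ZMod 2) (ModTwoLayer (FundamentalGroup M x) 1) : ℚ) =
        (rkModTwo M : ℚ) * ((rkModTwo M : ℚ) + 1) / 2 -
          (Module.finrank (ZMod 2) (cupSpan M) : ℚ)) ∧
    -- the first homology of a regular covering with covering group `(ℤ/2)^m`
    ∀ (m : ℕ) {E : Type v} [TopologicalSpace E] (p : E → M), IsRegularCovering p →
      Nonempty (deckGroup p ≃* Multiplicative (Fin m → ZMod 2)) →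
      Module.Finite (ZMod 2) (singularHomologyModTwo 1 E) ∧
      (rkModTwo E : ℚ) ≥ ((m : ℚ) + 1) * (rkModTwo M : ℚ) - (m : ℚ) * ((m : ℚ) + 1) / 2 -
        (Module.finrank (ZMod 2) (cupSpan M) : ℚ) := by
  have := hM.1
  have : LocallyPathConnectedSpace M :=
    ChartedSpace.locallyPathConnectedSpace (EuclideanSpace ℝ (Fin 3)) M
  have hfg (x : M) : Group.FG (FundamentalGroup M x) :=
    fundamentalGroup_fg (exists_simplyConnected_nhd (H := EuclideanSpace ℝ (Fin 3))) x
  have hfin (x : M) := finite_modTwoHoms_of_fg (FundamentalGroup M x)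
  obtain ⟨x₀⟩ : Nonempty M := inferInstance
  refine ⟨finite_singularHomology x₀, (finite_and_finrank_layer_eq M x₀).1, fun x => ?_,
    fun m E _ p hp ⟨f⟩ => finite_and_le_rkModTwo hfg hp f⟩
  obtain ⟨-, h1, h2⟩ := finite_and_finrank_layer_eq M x
  refine ⟨h1, ?_⟩
  rw [← cast_succ_choose_two, ← h2]
  push_cast
  ring
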